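/- **Setting.** Let $\mathcal G=(\mathcal V,\mathcal E)$ be a finite connected undirected graph on $N$ agents, with neighborhoods $\mathcal N_i$. Agent $i$ has $m_i$ data points and cost $f_i=\frac1{m_i}\sum_{h=1}^{m_i}f_{i,h}$ with $f_{i,h}:\mathbb R^n\to\mathbb R$ differentiable. Let $0<\mu\le L$, and let every $f_i$ be $L$-smooth ($\|\nabla f_i(x)-\nabla f_i(y)\|\le L\|x-y\|$) and $\mu$-strongly convex ($\langle\nabla f_i(x)-\nabla f_i(y),x-y\rangle\ge\mu\|x-y\|^2$). Let $x^*$ be the minimizer of $\sum_i f_i$. **Compressors.** Agent $i$ has a random operator $\mathcal C_i:\mathbb R^n\to\mathbb R^n$ with $\mathbb E[\mathcal C_i(x)]=x$ and $\mathbb E\|\mathcal C_i(x)-x\|^2\le p\|x\|^2$ for all $x$. It is applied to the node variables and to the edge variables of the agent with fresh randomness in each round; this randomness is independent across agents, across rounds, and between node and edge variables (the compressions of the different edge variables of one agent in one round may depend on each other). The batches below are uniform, mutually independent, and independent of the compressors. **Algorithm (LT-ADMM-CC).** Parameters: $\gamma,\beta,r,\rho>0$, $\eta\in(0,1]$, an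 integer $\tau\ge1$, and batch sizes $1\le b_i\le m_i$. Start from arbitrary $x_{i,0}\in\mathbb R^n$, $z_{ij,0}=x_{i,0}$, $u_{i,0}=0$, $s_{ij,0}=0$ ($j\in\mathcal N_i$). For all $k\ge0$ put $\hat x_{i,k}=u_{i,k}+\mathcal C_i(x_{i,k}-u_{i,k})$ and $\hat z_{ij,k}=s_{ij,k}+\mathcal C_i(z_{ij,k}-s_{ij,k})$. In round $k$ each agent sets $\phi^0_{i,k}=x_{i,k}$, $r^0_{i,h,k}=x_{i,k}$ for all $h$, and for $t=0,\dots,\tau-1$ draws a uniformly random batch $\mathcal B_i\subseteq\{1,\dots,m_i\}$ of size $b_i$ and computes $$g_i^t=\frac1{|\mathcal B_i|}\sum_{h\in\mathcal B_i}\bigl(\nabla f_{i,h}(\phi^t_{i,k})-\nabla f_{i,h}(r^t_{i,h,k})\bigr)+\frac1{m_i}\sum_{h=1}^{m_i}\nabla f_{i,h}(r^t_{i,h,k}),$$ $$\phi^{t+1}_{i,k}=\phi^t_{i,k}-\gamma g_i^t-\beta\Bigl(\rho|\mathcal N_i|\,r^2x_{i,k}-r\sum_{j\in\mathcal N_i}z_{ij,k}\Bigr),$$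 with $r^{t+1}_{i,h,k}=\phi^{t+1}_{i,k}$ if $h\in\mathcal B_i$ and $r^{t+1}_{i,h,k}=r^t_{i,h,k}$ otherwise. Then $x_{i,k+1}=\phi^\tau_{i,k}$, $u_{i,k+1}=(1-\eta)u_{i,k}+\eta\hat x_{i,k}$, $s_{ij,k+1}=\hat z_{ij,k}$, and $$z_{ij,k+1}=\tfrac12(\hat z_{ij,k}-\hat z_{ji,k})+r\rho\,x_{i,k+1}-r\rho(\hat x_{i,k+1}-\hat x_{j,k+1}).$$ **Theorem 1.** Fix the graph, $n$, $m_i$, $b_i$, $\mu$, $L$. There is $\bar p>1$ such that for every $p\in[0,\bar p]$ and every $\eta\in(0,1]$ with $\eta p<1$ there is $\bar\gamma>0$ such that for every $\gamma\in(0,\bar\gamma]$ there exist $\beta,r,\rho>0$, an integer $\tau\ge1$ and a rate $c\in(0,1)$ with the following property. For all costs and compressors as above and every starting point there is a constant $M$ such that the iterates $\mathbf X_k=(x_{i,k})_{i}$ have finite second moments and $$\mathbb E\|\mathbf X_k-\mathbf 1_N\otimes x^*\|^2\le M\,c^k\qquad\text{for all }k\ge0 .$$ -/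

import Mathlib

open MeasureTheory ProbabilityTheory
open scoped Gradient

namespace LTADMM

noncomputable section

/-- The parameter space `ℝⁿ` with its Euclidean norm. -/
abbrev Vec (n : ℕ) : Type := EuclideanSpace ℝ (Fin n)

/-- The parameters of the algorithm: step size `γ`, regularization weight `β`, the parameters
`r` and penalty `ρ`, error-feedback weight `η`, and the number `τ` of local training steps. -/
structure Params where
  γ : ℝ
  β : ℝ
  r : ℝ
  ρ : ℝ
  η : ℝ
  τ : ℕ

/-- `g` is `L`-smooth: differentiable with `L`-Lipschitz gradient. -/
def LSmooth {n : ℕ} (L : ℝ) (g : Vec n → ℝ) : Prop :=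
  Differentiable ℝ g ∧ ∀ x y, ‖∇ g x - ∇ g y‖ ≤ L * ‖x - y‖

/-- `g` is `μ`-strongly convex, expressed through the gradient of a differentiable `g`. -/
def StronglyConvex {n : ℕ} (μ : ℝ) (g : Vec n → ℝ) : Prop :=
  ∀ x y, μ * ‖x - y‖ ^ 2 ≤ inner ℝ (∇ g x - ∇ g y) (x - y)

/-- The local cost `fᵢ(x) = (1 / mᵢ) ∑ₕ fᵢₕ(x)` of an agent with `m` data points. -/
def localCost {n m : ℕ} (f : Fin m → Vec n → ℝ) (x : Vec n) : ℝ :=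
  (m : ℝ)⁻¹ * ∑ h, f h x

/-- The SAGA gradient estimator at `φ`, with batch `B` and table of points `R`. -/
def sagaGrad {n m : ℕ} (f : Fin m → Vec n → ℝ) (B : Finset (Fin m)) (φ : Vec n)
    (R : Fin m → Vec n) : Vec n :=
  (B.card : ℝ)⁻¹ • ∑ h ∈ B, (∇ (f h) φ - ∇ (f h) (R h)) + (m : ℝ)⁻¹ • ∑ h, ∇ (f h) (R h)

/-- Local training of one agent with `d` neighbors, starting at `x` and with `zsum = ∑ⱼ zᵢⱼ`:
the iterate `φᵗ` and the table of points `hᵗ` after `t` steps. The batch of step `t` is `B t`.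
The table is reset to `x` at the beginning. -/
def localIter {n m : ℕ} (a : Params) (f : Fin m → Vec n → ℝ) (d : ℕ) (x zsum : Vec n)
    (B : ℕ → Finset (Fin m)) : ℕ → Vec n × (Fin m → Vec n)
  | 0 => (x, fun _ => x)
  | t + 1 =>
    let φ := (localIter a f d x zsum B t).1
    let R := (localIter a f d x zsum B t).2
    let φ' := φ - a.γ • sagaGrad f (B t) φ R
      - (a.β * a.ρ * d) • (a.r ^ 2 • x - (a.r / (a.ρ * d)) • zsum)
    (φ', fun h => if h ∈ B t then φ' else R h)

/-- The state of the network. `z i j`, `s i j`, `zhat i j` are the edge variables kept by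
agent `i` for its neighbor `j`; values at non-adjacent pairs are never used.  The copies of
`u j` and `s j i` kept by the neighbors coincide with the originals. -/
structure State (V : Type*) (n : ℕ) where
  x : V → Vec n
  u : V → Vec n
  xhat : V → Vec n
  z : V → V → Vec n
  s : V → V → Vec n
  zhat : V → V → Vec n

section Algorithm

variable {V : Type*} [Fintype V] (G : SimpleGraph V) [DecidableRel G.Adj] {n : ℕ} {m : V → ℕ}

/-- The initial state: `z i j = x i` and `u = s = 0`.  Here `cx i` and `cz i j` are the
(realized) compressors that agent `i` applies to `x i - u i` and `z i j - s i j`. -/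
def initState (x₀ : V → Vec n) (cx : V → Vec n → Vec n) (cz : V → V → Vec n → Vec n) :
    State V n where
  x := x₀
  u := fun _ => 0
  xhat := fun i => 0 + cx i (x₀ i - 0)
  z := fun i _ => x₀ i
  s := fun _ _ => 0
  zhat := fun i j => 0 + cz i j (x₀ i - 0)

/-- One round: local training with the batches `B t i`, then communication with the (realized)
compressors `cx`, `cz`, then the update of the auxiliary variables. -/
def nextState (a : Params) (f : ∀ i, Fin (m i) → Vec n → ℝ)
    (B : ℕ → ∀ i, Finset (Fin (m i)))
    (cx : V → Vec n → Vec n) (cz : V → V → Vec n → Vec n) (σ : State V n) : State V n :=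
  let x' : V → Vec n := fun i =>
    (localIter a (f i) (G.degree i) (σ.x i) (∑ j ∈ G.neighborFinset i, σ.z i j)
      (fun t => B t i) a.τ).1
  let u' : V → Vec n := fun i => (1 - a.η) • σ.u i + a.η • σ.xhat i
  let s' : V → V → Vec n := σ.zhat
  let xhat' : V → Vec n := fun i => u' i + cx i (x' i - u' i)
  let z' : V → V → Vec n := fun i j =>
    (1 / 2 : ℝ) • (σ.zhat i j - σ.zhat j i) + (a.r * a.ρ) • x' i
      - (a.r * a.ρ) • (xhat' i - xhat' j)
  { x := x'
    u := u'
    xhat := xhat'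
    z := z'
    s := s'
    zhat := fun i j => s' i j + cz i j (z' i j - s' i j) }

/-- The state after `k` rounds.  `B k t i` is the batch of agent `i` in local step `t` of round
`k`; `cx k i` and `cz k i j` are the realized compressors for the index-`k` variables. -/
def run (a : Params) (f : ∀ i, Fin (m i) → Vec n → ℝ)
    (B : ℕ → ℕ → ∀ i, Finset (Fin (m i)))
    (cx : ℕ → V → Vec n → Vec n) (cz : ℕ → V → V → Vec n → Vec n) (x₀ : V → Vec n) :
    ℕ → State V n
  | 0 => initState x₀ (cx 0) (cz 0)
  | k + 1 => nextState G a f (B k) (cx (k + 1)) (cz (k + 1)) (run a f B cx cz x₀ k)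

end Algorithm

/-- A randomized compressor, driven by a seed of law `ν`: it is unbiased and has relative
variance at most `p`. -/
structure IsCompressor {S : Type*} [MeasurableSpace S] {n : ℕ} (ν : Measure S) (p : ℝ)
    (C : S → Vec n → Vec n) : Prop where
  measurable : Measurable (Function.uncurry C)
  unbiased : ∀ x, ∫ s, C s x ∂ν = x
  variance : ∀ x, ∫⁻ s, ‖C s x - x‖ₑ ^ 2 ∂ν ≤ ENNReal.ofReal (p * ‖x‖ ^ 2)

/-- The independent sources of randomness: for each agent `i` and each round `k`, the
compression of its local variable, the compression of its edge variables, and the batch of each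
local training step. -/
inductive Source (V : Type*) where
  | x (k : ℕ) (i : V)
  | z (k : ℕ) (i : V)
  | batch (k t : ℕ) (i : V)

/-- The information carried by each source. The seeds `ζ k i j` used by the same agent for
different neighbors `j` in the same round form a single source. -/
abbrev sourceAlgebra {V Ω S : Type*} [MeasurableSpace S] {m : V → ℕ}
    (ξ : ℕ → V → Ω → S) (ζ : ℕ → V → V → Ω → S)
    (B : ℕ → ℕ → ∀ i : V, Ω → Finset (Fin (m i))) : Source V → MeasurableSpace Ω
  | .x k i => MeasurableSpace.comap (ξ k i) inferInstance
  | .z k i => ⨆ j, MeasurableSpace.comap (ζ k i j) inferInstance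
  | .batch k t i => MeasurableSpace.comap (B k t i) ⊤

/-- The random inputs of the algorithm: agent `i` uses the compressor `C i`, with seed `ξ k i`
for its local variable and `ζ k i j` for the edge variable of its neighbor `j` in round `k`;
the batch `B k t i` is uniform among the sets of `b i` data points of agent `i`; the sources
are mutually independent. -/
structure IsRandomInput {V Ω S : Type*} [MeasurableSpace Ω] [MeasurableSpace S]
    (P : Measure Ω) (G : SimpleGraph V) {n : ℕ} {m : V → ℕ} (b : V → ℕ) (p : ℝ)
    (C : V → S → Vec n → Vec n) (ξ : ℕ → V → Ω → S) (ζ : ℕ → V → V → Ω → S)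
    (B : ℕ → ℕ → ∀ i : V, Ω → Finset (Fin (m i))) : Prop where
  measurable_ξ : ∀ k i, Measurable (ξ k i)
  measurable_ζ : ∀ k i j, Measurable (ζ k i j)
  measurable_B : ∀ k t i, Measurable[_, ⊤] (B k t i)
  compressor_x : ∀ k i, IsCompressor (P.map (ξ k i)) p (C i)
  compressor_z : ∀ k i j, G.Adj i j → IsCompressor (P.map (ζ k i j)) p (C i)
  uniform_B : ∀ k t i (A : Finset (Fin (m i))),
    P {ω | B k t i ω = A} = if A.card = b i then ((m i).choose (b i) : ENNReal)⁻¹ else 0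
  indep : iIndep (sourceAlgebra ξ ζ B) P

/-- The trajectory `x_{i,k}` of the algorithm, as random vectors. -/
def trajectory {V Ω S : Type*} [Fintype V] (G : SimpleGraph V) [DecidableRel G.Adj] {n : ℕ}
    {m : V → ℕ} (a : Params) (f : ∀ i, Fin (m i) → Vec n → ℝ)
    (C : V → S → Vec n → Vec n) (ξ : ℕ → V → Ω → S) (ζ : ℕ → V → V → Ω → S)
    (B : ℕ → ℕ → ∀ i : V, Ω → Finset (Fin (m i))) (x₀ : V → Vec n)
    (k : ℕ) (i : V) (ω : Ω) : Vec n :=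
  (run G a f (fun k t i => B k t i ω) (fun k i => C i (ξ k i ω))
    (fun k i j => C i (ζ k i j ω)) x₀ k).x i

end

end LTADMM

/-! The parameters `β`, `r`, `ρ`, `τ` may be chosen, and `r = ρ = τ = 1` suffices. With one local
step the SAGA table still sits at the starting point, so the estimator is the exact local gradient
and the batches drop out (`localIter_one`).

Every update makes `z i j + z j i = x i + x j`. Let D be the edge difference operator, P the
orthogonal projection onto its range, and F the sum of the local costs evaluated at separate copies.
A round then reads x' = x - γ∇F(x) - (β/4)DᵀDx + (β/2)Dᵀz and Pz' = Pz - ½Dx' + noise (`node_succ`,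
`rangeProj_edge_succ`). This is a primal-dual gradient method for minimizing F subject to Dx = 0.

Without noise, the energy ‖x - x*‖² + β‖P(z - z*)‖² drops by ‖x' - x‖²/4 + γμ‖x - x*‖²
(`primal_dual_descent`), and the same two quantities control the dual error (`dual_error_le`). The
noise is centered given the past, so it adds only its variance, of order βp times the squared gaps x
- u and z - s.

Both gaps contract up to primal terms. The node gap has factor (1-η)² + η²p < 1 before a Young
inequality. The edge gap inherits only the symmetric part of the previous edge noise. The two ends
of an edge compress independently, so its variance is p/2 instead of p
(`integral_symPart_edgeNoise_le`); this is what allows p to exceed 1.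

For small β a weighted sum of energy and gaps is a Lyapunov function (`linear_rate_of_recursion`).
Its rate involves only the graph, n, μ, L, p, η, γ and β, hence is uniform in costs, compressors and
starting points. -/

namespace LTADMM

noncomputable section

/-! ### Primal-dual inequalities in Hilbert space -/

section Hilbert

open ContinuousLinearMap InnerProductSpace

variable {H K : Type*} [NormedAddCommGroup H] [InnerProductSpace ℝ H]
  [NormedAddCommGroup K] [InnerProductSpace ℝ K]

theorem norm_add_sq_le_two (a b : H) : ‖a + b‖ ^ 2 ≤ 2 * ‖a‖ ^ 2 + 2 * ‖b‖ ^ 2 := by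
  have := parallelogram_law_with_norm ℝ a b
  nlinarith [sq_nonneg ‖a - b‖]

theorem norm_add_sq_le_young {θ : ℝ} (hθ : 0 < θ) (a b : H) :
    ‖a + b‖ ^ 2 ≤ (1 + θ) * ‖a‖ ^ 2 + (1 + θ⁻¹) * ‖b‖ ^ 2 := by
  have h := real_inner_le_norm a b
  have h2 : 2 * (‖a‖ * ‖b‖) ≤ θ * ‖a‖ ^ 2 + θ⁻¹ * ‖b‖ ^ 2 := by
    have : 0 ≤ θ⁻¹ * (θ * ‖a‖ - ‖b‖) ^ 2 := by positivity
    have e : θ⁻¹ * (θ * ‖a‖ - ‖b‖) ^ 2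
        = θ * ‖a‖ ^ 2 + θ⁻¹ * ‖b‖ ^ 2 - 2 * (‖a‖ * ‖b‖) := by
      field_simp
      ring
    linarith
  rw [norm_add_sq_real]
  linarith

variable [FiniteDimensional ℝ H]

/-- The orthogonal projection onto the range of a linear map. -/
def rangeProj (D : H →L[ℝ] K) : K →L[ℝ] K :=
  haveI : CompleteSpace D.range := FiniteDimensional.complete ℝ _
  D.range.starProjection

theorem rangeProj_apply_map (D : H →L[ℝ] K) (x : H) : rangeProj D (D x) = D x := by
  have : CompleteSpace D.range := FiniteDimensional.complete ℝ _
  exact Submodule.starProjection_eq_self_iff.2 (LinearMap.mem_range_self _ x)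

theorem inner_rangeProj_left (D : H →L[ℝ] K) (z w : K) :
    inner ℝ (rangeProj D z) w = inner ℝ z (rangeProj D w) := by
  have : CompleteSpace D.range := FiniteDimensional.complete ℝ _
  exact Submodule.inner_starProjection_left_eq_right _ _ _

theorem norm_rangeProj_le (D : H →L[ℝ] K) (z : K) : ‖rangeProj D z‖ ≤ ‖z‖ := by
  have : CompleteSpace D.range := FiniteDimensional.complete ℝ _
  exact Submodule.norm_starProjection_apply_le _ _

theorem rangeProj_eq_zero (D : H →L[ℝ] K) {z : K} (h : ∀ x, inner ℝ (D x) z = 0) :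
    rangeProj D z = 0 := by
  have : CompleteSpace D.range := FiniteDimensional.complete ℝ _
  refine (Submodule.starProjection_apply_eq_zero_iff _).2 ?_
  rintro _ ⟨x, rfl⟩
  exact h x

variable [FiniteDimensional ℝ K]

theorem adjoint_rangeProj (D : H →L[ℝ] K) (z : K) :
    adjoint D (rangeProj D z) = adjoint D z := by
  refine ext_inner_left ℝ fun x => ?_
  rw [adjoint_inner_right, adjoint_inner_right, ← inner_rangeProj_left, rangeProj_apply_map]

/-- Fredholm alternative: the orthogonal complement of the kernel is the closure of the range of the
adjoint, and that range is closed in finite dimension. -/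
theorem exists_adjoint_eq (D : H →L[ℝ] K) {v : H} (h : ∀ x, D x = 0 → inner ℝ x v = 0) :
    ∃ y, adjoint D y = v := by
  have hmem : v ∈ D.kerᗮ := (Submodule.mem_orthogonal _ _).2 fun x hx => h x hx
  rw [orthogonal_ker,
    (Submodule.closed_of_finiteDimensional _).submodule_topologicalClosure_eq] at hmem
  exact hmem

/-- The adjoint is injective on the range of `D`, hence bounded below there by finite
dimensionality. The primal update sees the dual variable only through the adjoint, so this is what
makes the dual error visible. -/
theorem exists_norm_rangeProj_sq_le (D : H →L[ℝ] K) :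
    ∃ c : ℝ, 0 < c ∧ ∀ z, ‖rangeProj D z‖ ^ 2 ≤ c * ‖adjoint D z‖ ^ 2 := by
  have : CompleteSpace D.range := FiniteDimensional.complete ℝ _
  let T : D.range →ₗ[ℝ] H := (adjoint D : K →L[ℝ] H).toLinearMap ∘ₗ D.range.subtype
  have hT : LinearMap.ker T = ⊥ := by
    rw [LinearMap.ker_eq_bot']
    rintro ⟨_, x, rfl⟩ hx
    have hx' : adjoint D (D x) = 0 := hx
    have h0 : inner ℝ (D x) (D x) = 0 := by
      rw [← adjoint_inner_right, hx', inner_zero_right]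
    exact Subtype.ext (inner_self_eq_zero.1 h0)
  obtain ⟨c, hc, hT⟩ := LinearMap.exists_antilipschitzWith T hT
  refine ⟨(c : ℝ) ^ 2, by positivity, fun z => ?_⟩
  have hz : rangeProj D z ∈ D.range := Submodule.starProjection_apply_mem _ _
  have h := hT.le_mul_norm (map_zero T) ⟨rangeProj D z, hz⟩
  have h' : ‖rangeProj D z‖ ≤ c * ‖adjoint D z‖ := by
    rw [← adjoint_rangeProj]
    exact h
  rw [← mul_pow]
  exact pow_le_pow_left₀ (norm_nonneg _) h' 2

/-- The primal-dual descent inequality for one noiseless round. -/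
theorem primal_dual_descent (D : H →L[ℝ] K) {γ β μ L : ℝ} (hγ : 0 < γ) (hβ : 0 < β)
    (hL : 2 * γ * L ^ 2 ≤ μ) (hD : ∀ x, β * ‖D x‖ ^ 2 ≤ ‖x‖ ^ 2)
    {x g d : H} {z : K} (hg : μ * ‖x‖ ^ 2 ≤ inner ℝ g x) (hgL : ‖g‖ ≤ L * ‖x‖)
    (hd : d = -(γ • g) - (β / 4) • adjoint D (D x) + (β / 2) • adjoint D z) :
    ‖x + d‖ ^ 2 + β * ‖rangeProj D z - (1 / 2 : ℝ) • D (x + d)‖ ^ 2 ≤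
      ‖x‖ ^ 2 + β * ‖rangeProj D z‖ ^ 2 - ‖d‖ ^ 2 / 4 - γ * μ * ‖x‖ ^ 2 := by
  -- Pairing `d` with the new point `x + d` makes the term in `z` from `h2` cancel against the one
  -- in `h3`, because the dual update also uses the new point.
  have h1 : ‖x + d‖ ^ 2 = ‖x‖ ^ 2 + 2 * inner ℝ d (x + d) - ‖d‖ ^ 2 := by
    rw [norm_add_sq_real, inner_add_right, real_inner_self_eq_norm_sq, real_inner_comm x d]
    ring
  have h2 : inner ℝ d (x + d) = -(γ * inner ℝ g (x + d)) - β / 4 * inner ℝ (D x) (D (x + d))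
      + β / 2 * inner ℝ z (D (x + d)) := by
    generalize x + d = y
    rw [hd, inner_add_left, inner_sub_left, inner_neg_left, inner_smul_left, inner_smul_left,
      inner_smul_left, adjoint_inner_left, adjoint_inner_left]
    simp
  have h3 : ‖rangeProj D z - (1 / 2 : ℝ) • D (x + d)‖ ^ 2 = ‖rangeProj D z‖ ^ 2
      - inner ℝ z (D (x + d)) + ‖D (x + d)‖ ^ 2 / 4 := by
    rw [norm_sub_sq_real, inner_smul_right, inner_rangeProj_left, rangeProj_apply_map, norm_smul]
    norm_num
    ring
  -- The mixed term cancels the one in `h2`. What remains is `β/4 * ‖D d‖ ^ 2`, at most `‖d‖ ^ 2 /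
  -- 4`, and a nonpositive term.
  have h4 : ‖D (x + d)‖ ^ 2 = ‖D d‖ ^ 2 - ‖D x‖ ^ 2 + 2 * inner ℝ (D x) (D (x + d)) := by
    rw [map_add, norm_add_sq_real, inner_add_right, real_inner_self_eq_norm_sq]
    ring
  have h5 : inner ℝ g (x + d) = inner ℝ g x + inner ℝ g d := inner_add_right _ _ _
  have h6 : -(‖g‖ * ‖d‖) ≤ inner ℝ g d := neg_le_of_abs_le (abs_real_inner_le_norm g d)
  have h7 : ‖g‖ * ‖d‖ ≤ L * ‖x‖ * ‖d‖ := by gcongr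
  -- Evaluating the gradient at the old point costs half of `‖d‖ ^ 2` and, by `hL`, half of the gain
  -- `2 * γ * μ * ‖x‖ ^ 2`.
  have h8 : 2 * γ * (L * ‖x‖ * ‖d‖) ≤ ‖d‖ ^ 2 / 2 + γ * (2 * γ * L ^ 2) * ‖x‖ ^ 2 := by
    nlinarith [sq_nonneg (‖d‖ - 2 * γ * L * ‖x‖)]
  have h9 : γ * (2 * γ * L ^ 2) * ‖x‖ ^ 2 ≤ γ * μ * ‖x‖ ^ 2 := by gcongr
  have h10 := hD d
  have h11 : 0 ≤ β * ‖D x‖ ^ 2 := by positivity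
  have h12 : γ * (μ * ‖x‖ ^ 2) ≤ γ * inner ℝ g x := by gcongr
  have h13 : γ * (-(L * ‖x‖ * ‖d‖)) ≤ γ * inner ℝ g d :=
    mul_le_mul_of_nonneg_left (by linarith) hγ.le
  rw [h1, h2, h3, h4, h5]
  nlinarith

/-- The dual error is controlled by the primal error and the primal increment. -/
theorem dual_error_le (D : H →L[ℝ] K) {γ β L cD cP : ℝ} (hβ : 0 < β)
    (hcD : 0 ≤ cD) (hD : ∀ x, ‖D x‖ ≤ cD * ‖x‖) (hγ : 0 < γ) (hcP : 0 ≤ cP)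
    (hP : ∀ z, ‖rangeProj D z‖ ^ 2 ≤ cP * ‖adjoint D z‖ ^ 2)
    {x g d : H} {z : K} (hgL : ‖g‖ ≤ L * ‖x‖)
    (hd : d = -(γ • g) - (β / 4) • adjoint D (D x) + (β / 2) • adjoint D z) :
    β ^ 2 * ‖rangeProj D z‖ ^ 2 ≤
      cP * 8 * (1 + (γ * L + β / 4 * cD ^ 2) ^ 2) * (‖d‖ ^ 2 + ‖x‖ ^ 2) := by
  -- The increment equation is solved for the dual term.
  have h1 : (β / 2) • adjoint D z = d + (γ • g + (β / 4) • adjoint D (D x)) := by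
    rw [hd]; abel
  have hDD : ‖adjoint D (D x)‖ ≤ cD ^ 2 * ‖x‖ := by
    have : ‖adjoint D‖ ≤ cD := by
      rw [LinearIsometryEquiv.norm_map]
      exact D.opNorm_le_bound hcD hD
    calc ‖adjoint D (D x)‖ ≤ ‖adjoint D‖ * ‖D x‖ := le_opNorm _ _
      _ ≤ cD * (cD * ‖x‖) := by gcongr; exact hD x
      _ = cD ^ 2 * ‖x‖ := by ring
  have h2 : ‖γ • g + (β / 4) • adjoint D (D x)‖ ≤ (γ * L + β / 4 * cD ^ 2) * ‖x‖ := by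
    refine (norm_add_le _ _).trans ?_
    rw [norm_smul, norm_smul, Real.norm_of_nonneg hγ.le, Real.norm_of_nonneg (by positivity)]
    nlinarith [mul_le_mul_of_nonneg_left hgL hγ.le,
      mul_le_mul_of_nonneg_left hDD (show 0 ≤ β / 4 by positivity)]
  have h3 : (β / 2) ^ 2 * ‖adjoint D z‖ ^ 2 ≤
      2 * ‖d‖ ^ 2 + 2 * ((γ * L + β / 4 * cD ^ 2) * ‖x‖) ^ 2 := by
    have e : (β / 2) ^ 2 * ‖adjoint D z‖ ^ 2 = ‖(β / 2) • adjoint D z‖ ^ 2 := by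
      rw [norm_smul, Real.norm_of_nonneg (by positivity)]; ring
    rw [e, h1]
    refine (norm_add_sq_le_two _ _).trans ?_
    gcongr
  set q := (γ * L + β / 4 * cD ^ 2)
  have h4 : β ^ 2 * ‖adjoint D z‖ ^ 2 ≤ 8 * (1 + q ^ 2) * (‖d‖ ^ 2 + ‖x‖ ^ 2) := by
    nlinarith [mul_nonneg (sq_nonneg q) (sq_nonneg ‖d‖), sq_nonneg ‖x‖]
  calc β ^ 2 * ‖rangeProj D z‖ ^ 2 ≤ β ^ 2 * (cP * ‖adjoint D z‖ ^ 2) := by gcongr; exact hP z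
    _ = cP * (β ^ 2 * ‖adjoint D z‖ ^ 2) := by ring
    _ ≤ cP * (8 * (1 + q ^ 2) * (‖d‖ ^ 2 + ‖x‖ ^ 2)) := by gcongr
    _ = _ := by ring

end Hilbert

/-! ### The edge difference operator of the graph -/

section Graph

variable {V : Type*} [Fintype V]

/-- Stacked node variables. -/
abbrev Nodes (V : Type*) (n : ℕ) : Type _ := PiLp 2 (fun _ : V => Vec n)

/-- Stacked edge variables. -/
abbrev Edges (V : Type*) (n : ℕ) : Type _ := PiLp 2 (fun _ : V × V => Vec n)

/-- The edge variables with value `a xᵢ + b xⱼ` at the edge `(i, j)`. -/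
def edgeMap (G : SimpleGraph V) [DecidableRel G.Adj] (n : ℕ) (a b : ℝ) :
    Nodes V n →L[ℝ] Edges V n :=
  (PiLp.continuousLinearEquiv 2 ℝ (fun _ : V × V => Vec n)).symm.toContinuousLinearMap ∘L
    ContinuousLinearMap.pi fun e => if G.Adj e.1 e.2 then
      a • PiLp.proj (𝕜 := ℝ) 2 (fun _ : V => Vec n) e.1 + b • PiLp.proj (𝕜 := ℝ) 2 (fun _ : V => Vec n) e.2 else 0

theorem edgeMap_apply (G : SimpleGraph V) [DecidableRel G.Adj] {n : ℕ} (a b : ℝ)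
    (x : Nodes V n) (e : V × V) :
    edgeMap G n a b x e = if G.Adj e.1 e.2 then a • x e.1 + b • x e.2 else 0 := by
  have : edgeMap G n a b x e = (if G.Adj e.1 e.2 then
      a • PiLp.proj (𝕜 := ℝ) 2 (fun _ : V => Vec n) e.1 + b • PiLp.proj (𝕜 := ℝ) 2 (fun _ : V => Vec n) e.2
      else 0 : Nodes V n →L[ℝ] Vec n) x := rfl
  rw [this]
  split_ifs <;> rfl

/-- The symmetric part of edge variables. -/
def symPart (V : Type*) [Fintype V] (n : ℕ) : Edges V n →L[ℝ] Edges V n :=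
  (PiLp.continuousLinearEquiv 2 ℝ (fun _ : V × V => Vec n)).symm.toContinuousLinearMap ∘L
    ContinuousLinearMap.pi (φ := fun _ : V × V => Vec n) fun e => ((1 / 2 : ℝ) •
      (PiLp.proj (𝕜 := ℝ) 2 (fun _ : V × V => Vec n) e + PiLp.proj (𝕜 := ℝ) 2 (fun _ : V × V => Vec n) e.swap) :
        Edges V n →L[ℝ] Vec n)

theorem symPart_apply {n : ℕ} (z : Edges V n) (e : V × V) :
    symPart V n z e = (1 / 2 : ℝ) • (z e + z e.swap) := rfl

theorem inner_edges {n : ℕ} (z w : Edges V n) :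
    inner ℝ z w = ∑ i, ∑ j, inner ℝ (z (i, j)) (w (i, j)) := by
  rw [PiLp.inner_apply, Fintype.sum_prod_type]

variable (G : SimpleGraph V) [DecidableRel G.Adj] {n : ℕ}

theorem adjoint_diff_apply (z : Edges V n) (i : V) :
    ContinuousLinearMap.adjoint (edgeMap G n 1 (-1)) z i
      = ∑ j ∈ G.neighborFinset i, (z (i, j) - z (j, i)) := by
  have key : ContinuousLinearMap.adjoint (edgeMap G n 1 (-1)) z
      = WithLp.toLp 2 fun i => ∑ j ∈ G.neighborFinset i, (z (i, j) - z (j, i)) := by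
    refine ext_inner_left ℝ fun x => ?_
    rw [ContinuousLinearMap.adjoint_inner_right, inner_edges, PiLp.inner_apply]
    have h1 : ∀ i j, inner ℝ (edgeMap G n 1 (-1) x (i, j)) (z (i, j))
        = (if G.Adj i j then inner ℝ (x i) (z (i, j)) else 0)
          - (if G.Adj i j then inner ℝ (x j) (z (i, j)) else 0) := by
      intro i j
      rw [edgeMap_apply]
      split_ifs
      · simp [inner_add_left, inner_neg_left, sub_eq_add_neg]
      · simp
    simp_rw [h1, Finset.sum_sub_distrib]
    rw [Finset.sum_comm (f := fun i j => if G.Adj i j then inner ℝ (x j) (z (i, j)) else 0),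
      ← Finset.sum_sub_distrib]
    refine Finset.sum_congr rfl fun i _ => ?_
    rw [inner_sub_right, inner_sum, inner_sum, SimpleGraph.neighborFinset_eq_filter,
      Finset.sum_filter, Finset.sum_filter]
    simp_rw [G.adj_comm i]
  rw [key]

/-- The adjoint depends only on differences `z (i, j) - z (j, i)`, so symmetric fields are
orthogonal to the range of the difference operator. -/
theorem rangeProj_diff_eq_zero_of_symm {z : Edges V n} (h : ∀ e, z e.swap = z e) :
    rangeProj (edgeMap G n 1 (-1)) z = 0 := by
  refine rangeProj_eq_zero _ fun x => ?_
  rw [← ContinuousLinearMap.adjoint_inner_right]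
  have : ContinuousLinearMap.adjoint (edgeMap G n 1 (-1)) z = 0 := by
    ext i : 1
    rw [adjoint_diff_apply]
    refine Finset.sum_eq_zero fun j _ => ?_
    rw [← h (i, j)]
    simp
  rw [this, inner_zero_right]

/-- On a connected graph the kernel of the difference operator consists of consensus vectors, and
`v` is orthogonal to these. This supplies the optimal dual variable. -/
theorem exists_adjoint_diff_eq (hG : G.Connected) {v : Nodes V n} (hv : ∑ i, v i = 0) :
    ∃ y, ContinuousLinearMap.adjoint (edgeMap G n 1 (-1)) y = v := by
  refine exists_adjoint_eq _ fun x hx => ?_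
  have hadj : ∀ i j, G.Adj i j → x i = x j := by
    intro i j hij
    have h : edgeMap G n 1 (-1) x (i, j) = 0 := by rw [hx]; rfl
    rw [edgeMap_apply, if_pos hij] at h
    simpa [sub_eq_zero, ← sub_eq_add_neg] using h
  obtain ⟨i₀⟩ := hG.nonempty
  have hconst : ∀ i, x i = x i₀ := by
    intro i
    obtain ⟨w⟩ := hG.preconnected i i₀
    induction w with
    | nil => rfl
    | cons h _ ih => exact (hadj _ _ h).trans ih
  rw [PiLp.inner_apply]
  simp_rw [hconst]
  rw [← inner_sum, hv, inner_zero_right]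

end Graph

/-! ### The Lyapunov function -/

/-- Linear convergence of the primal error `X` from coupled recursions with the dual error `Q`,
the compression errors `H` and `E` and the increment `D`. -/
theorem linear_rate_of_recursion {κ C₁ C₂ C₃ cD p a β : ℝ} (hκ1 : κ < 1)
    (hC₂ : 0 ≤ C₂) (hC₃ : 0 < C₃) (hcD : 0 ≤ cD) (hp : p ≤ 3 / 2)
    (ha : 0 < a) (hβ : 0 < β)
    (hβ1 : β * ((2 * (3 * cD + 48 * C₂) / (1 - κ) + (3 * cD + 48 * C₂)) * C₁ + 48 * C₂) ≤ 1 / 8)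
    (hβ2 : β * (48 * C₂) ≤ a / 2) :
    ∃ c : ℝ, 0 < c ∧ c < 1 ∧ ∀ X Q H E D : ℕ → ℝ,
      (∀ k, 0 ≤ X k) → (∀ k, 0 ≤ Q k) → (∀ k, 0 ≤ H k) → (∀ k, 0 ≤ E k) → (∀ k, 0 ≤ D k) →
      (∀ k, X (k + 1) + β * Q (k + 1) ≤ X k + β * Q k - D k / 4 - a * X k
        + 2 * β * p * (E k + cD * H (k + 1))) →
      (∀ k, H (k + 1) ≤ κ * H k + C₁ * D k) →
      (∀ k, E (k + 1) ≤ 7 / 8 * E k + C₂ * (D k + X k + H (k + 1))) →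
      (∀ k, β ^ 2 * Q k ≤ C₃ * (D k + X k)) →
      ∃ M, ∀ k, X k ≤ M * c ^ k := by
  -- `β * A` bounds the total weight with which `H (k + 1)` enters through the energy (using `2 * p
  -- ≤ 3`) and through `E`. The choice `K * (1 - κ) = 2 * A` absorbs it and keeps half of the
  -- contraction of `H`.
  set A := 3 * cD + 48 * C₂ with hA
  set K := 2 * A / (1 - κ) with hK
  have hA0 : 0 ≤ A := by positivity
  have hκ' : 0 < 1 - κ := by linarith
  have hK0 : 0 ≤ K := by positivity
  have hKA : K * (1 - κ) = 2 * A := by rw [hK]; field_simp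
  set s := min (1 / 8) (a / 4) with hs
  have hs0 : 0 < s := by positivity
  have hs8 : s ≤ 1 / 8 := min_le_left _ _
  have hsa : s ≤ a / 4 := min_le_right _ _
  set δ := min (min (a / 4) (s * β / C₃)) (min ((1 - κ) / 2) (1 / 16)) with hδ
  have hδ0 : 0 < δ := by positivity
  have hδ1 : δ ≤ a / 4 := (min_le_left _ _).trans (min_le_left _ _)
  have hδ2 : δ ≤ s * β / C₃ := (min_le_left _ _).trans (min_le_right _ _)
  have hδ3 : δ ≤ (1 - κ) / 2 := (min_le_right _ _).trans (min_le_left _ _)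
  have hδ4 : δ ≤ 1 / 16 := (min_le_right _ _).trans (min_le_right _ _)
  refine ⟨1 - δ, by linarith, by linarith, fun X Q H E D hX hQ hH hE hD h1 h2 h3 h4 => ?_⟩
  -- With weight 48 the decay `E / 8` yields `6 * β * E`; half of it pays for the noise term `3 * β
  -- * E` in the energy.
  set W : ℕ → ℝ := fun k => X k + β * Q k + K * β * H k + 48 * β * E k with hW
  have hstep : ∀ k, W (k + 1) ≤ (1 - δ) * W k := by
    intro k
    have hp1 : 2 * β * p * (E k + cD * H (k + 1)) ≤ 3 * β * (E k + cD * H (k + 1)) := by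
      have : 0 ≤ β * (E k + cD * H (k + 1)) :=
        mul_nonneg hβ.le (add_nonneg (hE k) (mul_nonneg hcD (hH _)))
      nlinarith
    have hEk : 48 * β * E (k + 1) ≤ 48 * β * (7 / 8 * E k + C₂ * (D k + X k + H (k + 1))) := by
      have := h3 k; gcongr
    have hHk : β * (K + A) * H (k + 1) ≤ β * (K + A) * (κ * H k + C₁ * D k) := by
      have := h2 k; gcongr
    have hD1 : β * ((K + A) * C₁ + 48 * C₂) * D k ≤ 1 / 8 * D k :=
      mul_le_mul_of_nonneg_right hβ1 (hD k)
    have hX1 : β * (48 * C₂) * X k ≤ a / 2 * X k := mul_le_mul_of_nonneg_right hβ2 (hX k)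
    have hHH : β * (K + A) * (κ * H k) ≤ β * K * (1 - (1 - κ) / 2) * H k := by
      have : β * (K + A) * (κ * H k) = β * H k * ((K + A) * κ) := by ring
      rw [this]
      have h5 : (K + A) * κ ≤ K * (1 - (1 - κ) / 2) := by nlinarith
      have := mul_le_mul_of_nonneg_left h5 (mul_nonneg hβ.le (hH k))
      linarith
    have hmain : W (k + 1) ≤ W k - D k / 8 - a / 2 * X k - β * K * ((1 - κ) / 2) * H k
        - 3 * β * E k := by
      simp only [hW]
      have := h1 k
      have e1 : β * (K + A) * H (k + 1) = K * β * H (k + 1) + 3 * β * (cD * H (k + 1))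
        + 48 * β * (C₂ * H (k + 1)) := by rw [hA]; ring
      linarith
    -- `Q` has no decay of its own; its share of the rate is taken from the unused decrease in `D`
    -- and `X`.
    have hQ1 : δ * (β * Q k) ≤ s * (D k + X k) := by
      calc δ * (β * Q k) ≤ s * β / C₃ * (β * Q k) :=
            mul_le_mul_of_nonneg_right hδ2 (mul_nonneg hβ.le (hQ k))
        _ = s / C₃ * (β ^ 2 * Q k) := by ring
        _ ≤ s / C₃ * (C₃ * (D k + X k)) := by have := h4 k; gcongr
        _ = s * (D k + X k) := by field_simp
    have q1 : s * D k ≤ 1 / 8 * D k := mul_le_mul_of_nonneg_right hs8 (hD k)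
    have q2 : s * X k ≤ a / 4 * X k := mul_le_mul_of_nonneg_right hsa (hX k)
    have q3 : δ * X k ≤ a / 4 * X k := mul_le_mul_of_nonneg_right hδ1 (hX k)
    have q4 : δ * (K * β * H k) ≤ (1 - κ) / 2 * (K * β * H k) :=
      mul_le_mul_of_nonneg_right hδ3 (by have := hH k; positivity)
    have q5 : δ * (48 * β * E k) ≤ 1 / 16 * (48 * β * E k) :=
      mul_le_mul_of_nonneg_right hδ4 (by have := hE k; positivity)
    have : (1 - δ) * W k = W k - (δ * X k + δ * (β * Q k) + δ * (K * β * H k)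
      + δ * (48 * β * E k)) := by simp only [hW]; ring
    rw [this]
    linarith
  refine ⟨W 0, fun k => ?_⟩
  have hWk : W k ≤ W 0 * (1 - δ) ^ k := by
    induction k with
    | zero => simp
    | succ k ih =>
      calc W (k + 1) ≤ (1 - δ) * W k := hstep k
        _ ≤ (1 - δ) * (W 0 * (1 - δ) ^ k) := mul_le_mul_of_nonneg_left ih (by linarith)
        _ = W 0 * (1 - δ) ^ (k + 1) := by ring
  have : X k ≤ W k := by
    have := hQ k; have := hH k; have := hE k
    simp only [hW]
    have : 0 ≤ β * Q k + K * β * H k + 48 * β * E k := by positivity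
    linarith
  exact this.trans hWk

/-! ### Adapted square integrable random vectors -/

section Adapted

variable {Ω : Type*} {𝓕 𝓖 mΩ : MeasurableSpace Ω} {P : Measure Ω}
  {E F : Type*} [NormedAddCommGroup E] [NormedAddCommGroup F]

/-- A square integrable random vector that is measurable with respect to a sub-σ-algebra `𝓕`. -/
structure AdaptedL2 (P : Measure[mΩ] Ω) (𝓕 : MeasurableSpace Ω) (f : Ω → E) : Prop where
  stronglyMeasurable : StronglyMeasurable[𝓕] f
  memLp : MemLp f 2 P

namespace AdaptedL2

variable {f g : Ω → E}

theorem mono (h : AdaptedL2 P 𝓕 f) (hle : 𝓕 ≤ 𝓖) : AdaptedL2 P 𝓖 f :=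
  ⟨h.1.mono hle, h.2⟩

theorem add (hf : AdaptedL2 P 𝓕 f) (hg : AdaptedL2 P 𝓕 g) :
    AdaptedL2 P 𝓕 (fun ω => f ω + g ω) := ⟨hf.1.add hg.1, hf.2.add hg.2⟩

theorem sub (hf : AdaptedL2 P 𝓕 f) (hg : AdaptedL2 P 𝓕 g) :
    AdaptedL2 P 𝓕 (fun ω => f ω - g ω) := ⟨hf.1.sub hg.1, hf.2.sub hg.2⟩

theorem const [IsFiniteMeasure P] (c : E) : AdaptedL2 P 𝓕 (fun _ : Ω => c) :=
  ⟨stronglyMeasurable_const, memLp_const c⟩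

theorem const_smul [NormedSpace ℝ E] (hf : AdaptedL2 P 𝓕 f) (c : ℝ) :
    AdaptedL2 P 𝓕 (fun ω => c • f ω) := ⟨hf.1.const_smul c, hf.2.const_smul c⟩

theorem clm [NormedSpace ℝ E] [NormedSpace ℝ F] (T : E →L[ℝ] F) (hf : AdaptedL2 P 𝓕 f) :
    AdaptedL2 P 𝓕 (fun ω => T (f ω)) :=
  ⟨T.continuous.comp_stronglyMeasurable hf.1, T.comp_memLp' hf.2⟩

theorem sum {ι : Type*} {s : Finset ι} {f : ι → Ω → E} (hf : ∀ i ∈ s, AdaptedL2 P 𝓕 (f i)) :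
    AdaptedL2 P 𝓕 (fun ω => ∑ i ∈ s, f i ω) :=
  ⟨Finset.stronglyMeasurable_fun_sum s fun i hi => (hf i hi).1,
    memLp_finsetSum s fun i hi => (hf i hi).2⟩

theorem lipschitz [IsFiniteMeasure P] {K : NNReal} {T : E → F} (hT : LipschitzWith K T)
    (hf : AdaptedL2 P 𝓕 f) : AdaptedL2 P 𝓕 (fun ω => T (f ω)) := by
  refine ⟨hT.continuous.comp_stronglyMeasurable hf.1, ?_⟩
  have h : LipschitzWith K (fun x => T x - T 0) := by
    refine LipschitzWith.of_dist_le_mul fun x y => ?_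
    simpa using hT.dist_le_mul x y
  have h2 := (h.comp_memLp (by simp) hf.2).add (memLp_const (T 0))
  simpa [Function.comp_def, Pi.add_def] using h2

theorem piLp {ι : Type*} [Fintype ι] {n : ℕ} {f : Ω → PiLp 2 (fun _ : ι => Vec n)}
    (hf : ∀ i, AdaptedL2 P 𝓕 (fun ω => f ω i)) : AdaptedL2 P 𝓕 f := by
  refine ⟨?_, MemLp.of_eval_piLp fun i => (hf i).2⟩
  have h : Measurable[𝓕] (fun ω => WithLp.ofLp (f ω)) :=
    @measurable_pi_lambda _ _ _ 𝓕 _ _ fun i => (hf i).1.measurable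
  have h2 : Measurable[𝓕] f := (WithLp.measurable_toLp 2 _).comp h
  exact h2.stronglyMeasurable

theorem integrable_norm_sq (hf : AdaptedL2 P 𝓕 f) : Integrable (fun ω => ‖f ω‖ ^ 2) P :=
  hf.2.integrable_norm_pow (by simp)

theorem integrable_inner [InnerProductSpace ℝ E] (hf : AdaptedL2 P 𝓕 f)
    (hg : AdaptedL2 P 𝓖 g) : Integrable (fun ω => (inner ℝ (f ω) (g ω) : ℝ)) P := by
  have h : ∀ ω, (inner ℝ (f ω) (g ω) : ℝ)
      = (1 / 2) * (‖f ω + g ω‖ ^ 2 - ‖f ω‖ ^ 2 - ‖g ω‖ ^ 2) := fun ω => by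
    rw [norm_add_sq_real]; ring
  simp_rw [h]
  have hfg : MemLp (fun ω => f ω + g ω) 2 P := hf.2.add hg.2
  exact (((hfg.integrable_norm_pow (by simp)).sub hf.integrable_norm_sq).sub
    hg.integrable_norm_sq).const_mul _

end AdaptedL2

end Adapted

/-! ### Fresh compression of an adapted vector -/

section Compressor

variable {Ω S : Type*} {𝓕 𝓖 mΩ : MeasurableSpace Ω} [MeasurableSpace S] {P : Measure Ω}
  [IsProbabilityMeasure P] {n : ℕ} {p : ℝ} {C : S → Vec n → Vec n} {ξ : Ω → S}
  {Y A : Ω → Vec n}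

/-- By Fubini on the product law, compressor properties stated for fixed vectors transfer to random
vectors independent of the seed. This replaces conditional expectations. -/
theorem map_prod_eq (h𝓕 : 𝓕 ≤ mΩ) (hξ : Measurable ξ)
    (hind : Indep (MeasurableSpace.comap ξ inferInstance) 𝓕 P) {α : Type*} [MeasurableSpace α]
    {Z : Ω → α} (hZ : Measurable[𝓕] Z) :
    P.map (fun ω => (ξ ω, Z ω)) = (P.map ξ).prod (P.map Z) := by
  have hi : IndepFun ξ Z P := indep_of_indep_of_le_right hind hZ.comap_le
  exact (indepFun_iff_map_prod_eq_prod_map_map hξ.aemeasurable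
    (hZ.mono h𝓕 le_rfl).aemeasurable).1 hi

theorem lintegral_compression_error_le (h𝓕 : 𝓕 ≤ mΩ) (hξ : Measurable ξ)
    (hind : Indep (MeasurableSpace.comap ξ inferInstance) 𝓕 P)
    (hC : IsCompressor (P.map ξ) p C) (hY : Measurable[𝓕] Y) :
    ∫⁻ ω, ‖C (ξ ω) (Y ω) - Y ω‖ₑ ^ 2 ∂P ≤ ∫⁻ ω, ENNReal.ofReal (p * ‖Y ω‖ ^ 2) ∂P := by
  have hYm : Measurable Y := hY.mono h𝓕 le_rfl
  have hm : Measurable fun q : S × Vec n => ‖C q.1 q.2 - q.2‖ₑ ^ 2 :=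
    ((hC.measurable.sub measurable_snd).enorm).pow_const 2
  have : IsProbabilityMeasure (P.map ξ) := Measure.isProbabilityMeasure_map hξ.aemeasurable
  have : IsProbabilityMeasure (P.map Y) := Measure.isProbabilityMeasure_map hYm.aemeasurable
  calc ∫⁻ ω, ‖C (ξ ω) (Y ω) - Y ω‖ₑ ^ 2 ∂P
      = ∫⁻ q, ‖C q.1 q.2 - q.2‖ₑ ^ 2 ∂(P.map fun ω => (ξ ω, Y ω)) :=
        (lintegral_map hm (hξ.prodMk hYm)).symm
    _ = ∫⁻ y, ∫⁻ s, ‖C s y - y‖ₑ ^ 2 ∂(P.map ξ) ∂(P.map Y) := by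
        rw [map_prod_eq h𝓕 hξ hind hY, lintegral_prod_symm' _ hm]
    _ ≤ ∫⁻ y, ENNReal.ofReal (p * ‖y‖ ^ 2) ∂(P.map Y) := lintegral_mono fun y => hC.variance y
    _ = _ := lintegral_map (by fun_prop) hYm

theorem AdaptedL2.compression_error (h𝓕𝓖 : 𝓕 ≤ 𝓖) (h𝓖 : 𝓖 ≤ mΩ)
    (hξ : Measurable[𝓖] ξ) (hind : Indep (MeasurableSpace.comap ξ inferInstance) 𝓕 P)
    (hC : IsCompressor (P.map ξ) p C) (hY : AdaptedL2 P 𝓕 Y) :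
    AdaptedL2 P 𝓖 (fun ω => C (ξ ω) (Y ω) - Y ω) := by
  have hY𝓖 : Measurable[𝓖] Y := (hY.1.mono h𝓕𝓖).measurable
  have hm : Measurable[𝓖] (fun ω => C (ξ ω) (Y ω) - Y ω) :=
    (hC.measurable.comp (hξ.prodMk hY𝓖)).sub hY𝓖
  refine ⟨hm.stronglyMeasurable, ?_⟩
  have hle := lintegral_compression_error_le (h𝓕𝓖.trans h𝓖) (hξ.mono h𝓖 le_rfl) hind hC
    hY.1.measurable
  have hint : Integrable (fun ω => p * ‖Y ω‖ ^ 2) P := hY.integrable_norm_sq.const_mul p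
  refine (memLp_two_iff_integrable_sq_norm
    (hm.mono h𝓖 le_rfl).aestronglyMeasurable).2 ⟨?_, ?_⟩
  · exact ((hm.mono h𝓖 le_rfl).norm.pow_const 2).aestronglyMeasurable
  · refine lt_of_le_of_lt ?_ (hle.trans_lt hint.lintegral_lt_top)
    refine lintegral_mono fun ω => ?_
    simp [enorm_pow]

theorem integral_compression_error_le (h𝓕 : 𝓕 ≤ mΩ) (hp : 0 ≤ p)
    (hξ : Measurable ξ) (hind : Indep (MeasurableSpace.comap ξ inferInstance) 𝓕 P)
    (hC : IsCompressor (P.map ξ) p C) (hY : AdaptedL2 P 𝓕 Y) :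
    ∫ ω, ‖C (ξ ω) (Y ω) - Y ω‖ ^ 2 ∂P ≤ p * ∫ ω, ‖Y ω‖ ^ 2 ∂P := by
  have hle := lintegral_compression_error_le h𝓕 hξ hind hC hY.1.measurable
  have hw := (AdaptedL2.compression_error h𝓕 le_rfl hξ hind hC hY).integrable_norm_sq
  have hint : Integrable (fun ω => p * ‖Y ω‖ ^ 2) P := hY.integrable_norm_sq.const_mul p
  rw [← integral_const_mul]
  rw [← ofReal_integral_eq_lintegral_ofReal hint
    (Filter.Eventually.of_forall fun ω => by positivity)] at hle
  have e : ∫⁻ ω, ‖C (ξ ω) (Y ω) - Y ω‖ₑ ^ 2 ∂P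
      = ENNReal.ofReal (∫ ω, ‖C (ξ ω) (Y ω) - Y ω‖ ^ 2 ∂P) := by
    rw [ofReal_integral_eq_lintegral_ofReal hw
      (Filter.Eventually.of_forall fun ω => by positivity)]
    refine lintegral_congr fun ω => ?_
    rw [ENNReal.ofReal_pow (norm_nonneg _), ofReal_norm]
  rw [e] at hle
  exact (ENNReal.ofReal_le_ofReal_iff (integral_nonneg fun ω => by positivity)).1 hle

/-- With `Y` and `A` frozen jointly, the inner integral over the seed vanishes by unbiasedness. -/
theorem integral_inner_compression_error (h𝓕 : 𝓕 ≤ mΩ)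
    (hξ : Measurable ξ) (hind : Indep (MeasurableSpace.comap ξ inferInstance) 𝓕 P)
    (hC : IsCompressor (P.map ξ) p C) (hY : AdaptedL2 P 𝓕 Y) (hA : AdaptedL2 P 𝓕 A) :
    ∫ ω, inner ℝ (C (ξ ω) (Y ω) - Y ω) (A ω) ∂P = 0 := by
  have hw := AdaptedL2.compression_error h𝓕 le_rfl hξ hind hC hY
  have hint := hw.integrable_inner (hA.mono h𝓕)
  have hZ : Measurable[𝓕] fun ω => (Y ω, A ω) := hY.1.measurable.prodMk hA.1.measurable
  have hZm : Measurable fun ω => (Y ω, A ω) := hZ.mono h𝓕 le_rfl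
  have : IsProbabilityMeasure (P.map ξ) := Measure.isProbabilityMeasure_map hξ.aemeasurable
  have : IsProbabilityMeasure (P.map fun ω => (Y ω, A ω)) :=
    Measure.isProbabilityMeasure_map hZm.aemeasurable
  have hm : Measurable fun q : S × (Vec n × Vec n) =>
      (inner ℝ (C q.1 q.2.1 - q.2.1) q.2.2 : ℝ) :=
    ((hC.measurable.comp (measurable_fst.prodMk measurable_snd.fst)).sub
      measurable_snd.fst).inner measurable_snd.snd
  have hmap := map_prod_eq h𝓕 hξ hind hZ
  have hint' : Integrable (fun q : S × (Vec n × Vec n) =>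
      (inner ℝ (C q.1 q.2.1 - q.2.1) q.2.2 : ℝ))
      ((P.map ξ).prod (P.map fun ω => (Y ω, A ω))) := by
    rw [← hmap]
    exact (integrable_map_measure hm.aestronglyMeasurable (hξ.prodMk hZm).aemeasurable).2 hint
  calc ∫ ω, inner ℝ (C (ξ ω) (Y ω) - Y ω) (A ω) ∂P
      = ∫ q : S × (Vec n × Vec n), inner ℝ (C q.1 q.2.1 - q.2.1) q.2.2
          ∂(P.map fun ω => (ξ ω, (Y ω, A ω))) :=
        (integral_map (hξ.prodMk hZm).aemeasurable hm.aestronglyMeasurable).symm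
    _ = ∫ y : Vec n × Vec n, ∫ s, inner ℝ (C s y.1 - y.1) y.2 ∂(P.map ξ)
          ∂(P.map fun ω => (Y ω, A ω)) := by
        rw [hmap, integral_prod_symm _ hint']
    _ = ∫ y : Vec n × Vec n, (0 : ℝ) ∂(P.map fun ω => (Y ω, A ω)) := by
        refine integral_congr_ae (Filter.Eventually.of_forall fun y => ?_)
        have hCm : Measurable fun s => C s y.1 - y.1 :=
          (hC.measurable.comp measurable_prodMk_right).sub_const _
        have h2 : MemLp (fun s => C s y.1 - y.1) 2 (P.map ξ) := by
          refine (memLp_two_iff_integrable_sq_norm hCm.aestronglyMeasurable).2 ⟨?_, ?_⟩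
          · exact (hCm.norm.pow_const 2).aestronglyMeasurable
          · refine lt_of_le_of_lt ?_ ((hC.variance y.1).trans_lt ENNReal.ofReal_lt_top)
            exact lintegral_mono fun ω => by simp [enorm_pow]
        have h1 : Integrable (fun s => C s y.1 - y.1) (P.map ξ) := h2.integrable (by norm_num)
        have h0 : ∫ s, (C s y.1 - y.1) ∂(P.map ξ) = 0 := by
          have h1' : Integrable (fun s => C s y.1) (P.map ξ) := by
            exact (h1.add (integrable_const y.1)).congr
              (Filter.Eventually.of_forall fun s => by simp)
          rw [integral_sub h1' (integrable_const _), hC.unbiased]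
          simp
        simp_rw [real_inner_comm y.2]
        rw [integral_inner h1, h0, inner_zero_right]
    _ = 0 := by simp

end Compressor

/-! ### One round with a single local step, in stacked form -/

theorem gradient_localCost {n m : ℕ} {f : Fin m → Vec n → ℝ} (hf : ∀ h, Differentiable ℝ (f h))
    (x : Vec n) : ∇ (localCost f) x = (m : ℝ)⁻¹ • ∑ h, ∇ (f h) x := by
  have h1 : fderiv ℝ (localCost f) x = (m : ℝ)⁻¹ • ∑ h, fderiv ℝ (f h) x := by
    have h2 : DifferentiableAt ℝ (fun y => ∑ h, f h y) x :=
      DifferentiableAt.fun_sum fun h _ => hf h x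
    change fderiv ℝ (fun y => (m : ℝ)⁻¹ * ∑ h, f h y) x = _
    rw [fderiv_const_mul h2, fderiv_fun_sum fun h _ => hf h x]
  simp only [gradient, h1, map_smul, map_sum]

theorem localIter_one {n m : ℕ} {f : Fin m → Vec n → ℝ} (hf : ∀ h, Differentiable ℝ (f h))
    (γ β η : ℝ) (d : ℕ) (x zsum : Vec n) (hz : d = 0 → zsum = 0) (B : ℕ → Finset (Fin m)) :
    (localIter ⟨γ, β, 1, 1, η, 1⟩ f d x zsum B 1).1
      = x - γ • ∇ (localCost f) x - β • ((d : ℝ) • x - zsum) := by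
  have h1 : (β * 1 * d) • ((1 : ℝ) ^ 2 • x - ((1 : ℝ) / (1 * d)) • zsum)
      = β • ((d : ℝ) • x - zsum) := by
    -- An isolated agent occurs when the graph has one vertex; then `d = 0` makes the whole left
    -- side zero, and `hz` does the same on the right.
    rcases Nat.eq_zero_or_pos d with rfl | hd
    · simp [hz rfl]
    · have : (d : ℝ) ≠ 0 := by positivity
      simp only [smul_sub, smul_smul]
      congr 2 <;> field_simp
  simp only [localIter, sagaGrad, sub_self, Finset.sum_const_zero, smul_zero, zero_add, h1,
    gradient_localCost hf]

namespace State

variable {V : Type*} [Fintype V] (G : SimpleGraph V) [DecidableRel G.Adj] {n : ℕ}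

/-- The stacked node variables of a state. -/
def node (σ : State V n) : Nodes V n := WithLp.toLp 2 σ.x

/-- The stacked errors `x - u` of the reference points of the nodes. -/
def nodeGap (σ : State V n) : Nodes V n := WithLp.toLp 2 fun i => σ.x i - σ.u i

/-- The stacked compression errors of the nodes. -/
def nodeNoise (σ : State V n) : Nodes V n := WithLp.toLp 2 fun i => σ.xhat i - σ.x i

/-- The stacked edge variables, set to zero outside the edges. -/
def edge (σ : State V n) : Edges V n :=
  WithLp.toLp 2 fun e => if G.Adj e.1 e.2 then σ.z e.1 e.2 else 0

/-- The stacked errors `z - s` of the reference points of the edges. -/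
def edgeGap (σ : State V n) : Edges V n :=
  WithLp.toLp 2 fun e => if G.Adj e.1 e.2 then σ.z e.1 e.2 - σ.s e.1 e.2 else 0

/-- The stacked compression errors of the edges. -/
def edgeNoise (σ : State V n) : Edges V n :=
  WithLp.toLp 2 fun e => if G.Adj e.1 e.2 then σ.zhat e.1 e.2 - σ.z e.1 e.2 else 0

end State

/-- The stacked gradients of the local costs. -/
def stackedGrad {V : Type*} {n : ℕ} {m : V → ℕ} (f : ∀ i, Fin (m i) → Vec n → ℝ)
    (x : Nodes V n) : Nodes V n :=
  WithLp.toLp 2 fun i => ∇ (localCost (f i)) (x i)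

section Run

variable {V : Type*} [Fintype V] (G : SimpleGraph V) [DecidableRel G.Adj] {n : ℕ} {m : V → ℕ}
  (γ β η : ℝ) (f : ∀ i, Fin (m i) → Vec n → ℝ) (B : ℕ → ℕ → ∀ i, Finset (Fin (m i)))
  (cx : ℕ → V → Vec n → Vec n) (cz : ℕ → V → V → Vec n → Vec n) (x₀ : V → Vec n) (k : ℕ)

local notation "σ" => run G (Params.mk γ β 1 1 η 1) f B cx cz x₀

theorem run_x_succ (hf : ∀ i h, Differentiable ℝ (f i h)) (i : V) :
    (σ (k + 1)).x i = (σ k).x i - γ • ∇ (localCost (f i)) ((σ k).x i)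
      - β • ∑ j ∈ G.neighborFinset i, ((σ k).x i - (σ k).z i j) := by
  have h := localIter_one (hf i) γ β η (G.degree i) ((σ k).x i)
    (∑ j ∈ G.neighborFinset i, (σ k).z i j) (fun h0 => by
      rw [← SimpleGraph.card_neighborFinset_eq_degree, Finset.card_eq_zero] at h0
      rw [h0, Finset.sum_empty]) (fun t => B k t i)
  rw [Finset.sum_sub_distrib, Finset.sum_const, SimpleGraph.card_neighborFinset_eq_degree,
    ← Nat.cast_smul_eq_nsmul ℝ]
  exact h

theorem run_u_succ (i : V) :
    (σ (k + 1)).u i = (1 - η) • (σ k).u i + η • (σ k).xhat i := rfl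

theorem run_s_succ (i j : V) : (σ (k + 1)).s i j = (σ k).zhat i j := rfl

theorem run_xhat (i : V) :
    (σ k).xhat i = (σ k).u i + cx k i ((σ k).x i - (σ k).u i) := by
  cases k <;> rfl

theorem run_zhat (i j : V) :
    (σ k).zhat i j = (σ k).s i j + cz k i j ((σ k).z i j - (σ k).s i j) := by
  cases k <;> rfl

theorem run_z_succ (i j : V) :
    (σ (k + 1)).z i j = (1 / 2 : ℝ) • ((σ k).zhat i j - (σ k).zhat j i) + (σ (k + 1)).x i
      - ((σ (k + 1)).xhat i - (σ (k + 1)).xhat j) := by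
  have h : (σ (k + 1)).z i j = (1 / 2 : ℝ) • ((σ k).zhat i j - (σ k).zhat j i)
      + ((1 : ℝ) * 1) • (σ (k + 1)).x i
      - ((1 : ℝ) * 1) • ((σ (k + 1)).xhat i - (σ (k + 1)).xhat j) := rfl
  rw [h, one_mul, one_smul, one_smul]

/-- Both the half-difference of the `zhat` and the term in `xhat` are antisymmetric, so the identity
holds after any update, whatever the compressors do. -/
theorem run_z_add_z_swap (i j : V) :
    (σ k).z i j + (σ k).z j i = (σ k).x i + (σ k).x j := by
  cases k with
  | zero => rfl
  | succ k =>
    rw [run_z_succ, run_z_succ]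
    module

/-- By the symmetry invariant, each `x i - z i j` splits into half of `x i - x j` minus half of `z i
j - z j i`. The adjoint over ordered pairs counts every edge twice, whence the factors 1/4 and 1/2.
-/
theorem node_succ (hf : ∀ i h, Differentiable ℝ (f i h)) :
    (σ (k + 1)).node = (σ k).node + (-(γ • stackedGrad f (σ k).node)
      - (β / 4) • ContinuousLinearMap.adjoint (edgeMap G n 1 (-1))
        (edgeMap G n 1 (-1) (σ k).node)
      + (β / 2) • ContinuousLinearMap.adjoint (edgeMap G n 1 (-1)) ((σ k).edge G)) := by
  ext i : 1
  have h1 : ContinuousLinearMap.adjoint (edgeMap G n 1 (-1)) (edgeMap G n 1 (-1) (σ k).node) i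
      = ∑ j ∈ G.neighborFinset i, (2 : ℝ) • ((σ k).x i - (σ k).x j) := by
    rw [adjoint_diff_apply]
    refine Finset.sum_congr rfl fun j hj => ?_
    have hij : G.Adj i j := (G.mem_neighborFinset i j).1 hj
    rw [edgeMap_apply, edgeMap_apply, if_pos hij, if_pos hij.symm]
    simp only [State.node]
    module
  have h2 : ContinuousLinearMap.adjoint (edgeMap G n 1 (-1)) ((σ k).edge G) i
      = ∑ j ∈ G.neighborFinset i, ((σ k).z i j - (σ k).z j i) := by
    rw [adjoint_diff_apply]
    refine Finset.sum_congr rfl fun j hj => ?_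
    have hij : G.Adj i j := (G.mem_neighborFinset i j).1 hj
    simp only [State.edge, if_pos hij, if_pos hij.symm]
  have h3 : β • ∑ j ∈ G.neighborFinset i, ((σ k).x i - (σ k).z i j)
      = (β / 4) • (∑ j ∈ G.neighborFinset i, (2 : ℝ) • ((σ k).x i - (σ k).x j))
        - (β / 2) • ∑ j ∈ G.neighborFinset i, ((σ k).z i j - (σ k).z j i) := by
    simp only [Finset.smul_sum]
    rw [← Finset.sum_sub_distrib]
    refine Finset.sum_congr rfl fun j _ => ?_
    rw [eq_sub_of_add_eq' (run_z_add_z_swap G γ β η f B cx cz x₀ k i j)]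
    module
  simp only [PiLp.add_apply, PiLp.sub_apply, PiLp.neg_apply, PiLp.smul_apply, h1, h2]
  change (σ (k + 1)).x i = _
  rw [run_x_succ G γ β η f B cx cz x₀ k hf, h3]
  simp only [State.node, stackedGrad]
  abel

theorem nodeGap_succ :
    (σ (k + 1)).nodeGap = ((σ (k + 1)).node - (σ k).node)
      + ((1 - η) • (σ k).nodeGap - η • (σ k).nodeNoise) := by
  ext i : 1
  simp only [State.node, State.nodeGap, State.nodeNoise, PiLp.add_apply, PiLp.sub_apply,
    PiLp.smul_apply, run_u_succ]
  module

/-- The unprojected recursion holds up to a symmetric field, which the projection kills. -/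
theorem rangeProj_edge_succ :
    rangeProj (edgeMap G n 1 (-1)) ((σ (k + 1)).edge G)
      = (rangeProj (edgeMap G n 1 (-1)) ((σ k).edge G)
        - (1 / 2 : ℝ) • edgeMap G n 1 (-1) (σ (k + 1)).node)
      + (rangeProj (edgeMap G n 1 (-1)) ((σ k).edgeNoise G)
        - edgeMap G n 1 (-1) (σ (k + 1)).nodeNoise) := by
  have h : rangeProj (edgeMap G n 1 (-1)) ((σ (k + 1)).edge G - ((σ k).edge G
      - (1 / 2 : ℝ) • edgeMap G n 1 (-1) (σ (k + 1)).node
      + ((σ k).edgeNoise G - edgeMap G n 1 (-1) (σ (k + 1)).nodeNoise))) = 0 := by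
    refine rangeProj_diff_eq_zero_of_symm G fun e => ?_
    simp only [PiLp.add_apply, PiLp.sub_apply, PiLp.smul_apply, edgeMap_apply, State.edge,
      State.edgeNoise, State.node, State.nodeNoise, Prod.fst_swap, Prod.snd_swap,
      G.adj_comm e.2 e.1]
    split_ifs
    · rw [run_z_succ, run_z_succ]
      module
    · rfl
  rw [map_sub, sub_eq_zero] at h
  rw [h]
  simp only [map_add, map_sub, map_smul, rangeProj_apply_map]

/-- Since `s` is reset to the previous `zhat`, subtracting it from the antisymmetrized `zhat` leaves
minus its symmetric part. The symmetric part of `z` is known from `x`, so only noise and primal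
terms remain. -/
theorem edgeGap_succ :
    (σ (k + 1)).edgeGap G = -(symPart V n ((σ k).edgeNoise G))
      + (edgeMap G n (1 / 2) (1 / 2) ((σ (k + 1)).node - (σ k).node)
        - (1 / 2 : ℝ) • edgeMap G n 1 (-1) (σ (k + 1)).node
        - edgeMap G n 1 (-1) (σ (k + 1)).nodeNoise) := by
  ext e : 1
  simp only [PiLp.add_apply, PiLp.sub_apply, PiLp.smul_apply, PiLp.neg_apply, edgeMap_apply,
    symPart_apply, State.edgeGap, State.edgeNoise, State.node, State.nodeNoise, Prod.fst_swap,
    Prod.snd_swap, G.adj_comm e.2 e.1]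
  split_ifs
  · have h := eq_sub_of_add_eq' (run_z_add_z_swap G γ β η f B cx cz x₀ k e.1 e.2)
    rw [run_z_succ, run_s_succ, h]
    module
  · simp

end Run

/-! ### Expectations of stacked vectors -/

section Stacked

variable {Ω : Type*} {𝓕 𝓕' mΩ : MeasurableSpace Ω} {P : Measure Ω} {n : ℕ}

theorem integral_norm_sq_piLp {ι : Type*} [Fintype ι] {Y : Ω → PiLp 2 (fun _ : ι => Vec n)}
    (hY : MemLp Y 2 P) : ∫ ω, ‖Y ω‖ ^ 2 ∂P = ∑ i, ∫ ω, ‖Y ω i‖ ^ 2 ∂P := by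
  have e : ∀ ω, ‖Y ω‖ ^ 2 = ∑ i, ‖Y ω i‖ ^ 2 := fun ω => PiLp.norm_sq_eq_of_L2 _ (Y ω)
  simp_rw [e]
  exact integral_finsetSum _ fun i _ => (hY.eval_piLp i).integrable_norm_pow (by simp)

theorem AdaptedL2.eval_piLp {ι : Type*} [Fintype ι] {Y : Ω → PiLp 2 (fun _ : ι => Vec n)} (hY : AdaptedL2 P 𝓕 Y) (i : ι) :
    AdaptedL2 P 𝓕 fun ω => Y ω i :=
  hY.clm (PiLp.proj (𝕜 := ℝ) 2 (fun _ : ι => Vec n) i)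

theorem integral_inner_piLp {ι : Type*} [Fintype ι] {Y A : Ω → PiLp 2 (fun _ : ι => Vec n)} (hY : AdaptedL2 P 𝓕 Y) (hA : AdaptedL2 P 𝓕' A) :
    ∫ ω, inner ℝ (Y ω) (A ω) ∂P = ∑ i, ∫ ω, inner ℝ (Y ω i) (A ω i) ∂P := by
  have e : ∀ ω, (inner ℝ (Y ω) (A ω) : ℝ) = ∑ i, inner ℝ (Y ω i) (A ω i) :=
    fun ω => PiLp.inner_apply _ _
  simp_rw [e]
  exact integral_finsetSum _ fun i _ => (hY.eval_piLp i).integrable_inner (hA.eval_piLp i)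

theorem integral_norm_add_sq {E : Type*} [NormedAddCommGroup E] [InnerProductSpace ℝ E]
    {Y A : Ω → E} (hY : AdaptedL2 P 𝓕 Y) (hA : AdaptedL2 P 𝓕' A) :
    ∫ ω, ‖Y ω + A ω‖ ^ 2 ∂P
      = ∫ ω, ‖Y ω‖ ^ 2 ∂P + 2 * ∫ ω, inner ℝ (Y ω) (A ω) ∂P + ∫ ω, ‖A ω‖ ^ 2 ∂P := by
  have i1 := (hY.integrable_inner hA).const_mul 2
  have i2 : Integrable (fun ω => ‖Y ω‖ ^ 2 + 2 * inner ℝ (Y ω) (A ω)) P :=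
    hY.integrable_norm_sq.add i1
  simp_rw [norm_add_sq_real]
  rw [integral_add i2 hA.integrable_norm_sq, integral_add hY.integrable_norm_sq i1,
    integral_const_mul]

end Stacked

/-! ### Independence of the sources -/

section Sources

variable {V Ω S : Type*} [MeasurableSpace Ω] [MeasurableSpace S] {P : Measure Ω}
  {G : SimpleGraph V} {n : ℕ} {m b : V → ℕ} {p : ℝ} {C : V → S → Vec n → Vec n}
  {ξ : ℕ → V → Ω → S} {ζ : ℕ → V → V → Ω → S} {B : ℕ → ℕ → ∀ i : V, Ω → Finset (Fin (m i))}

/-- The information carried by a set of sources. -/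
def sourceSigma (ξ : ℕ → V → Ω → S) (ζ : ℕ → V → V → Ω → S)
    (B : ℕ → ℕ → ∀ i : V, Ω → Finset (Fin (m i))) (T : Set (Source V)) : MeasurableSpace Ω :=
  ⨆ s ∈ T, sourceAlgebra ξ ζ B s

/-- The compression sources on which the node variables of round `k` depend. -/
def past (V : Type*) (k : ℕ) : Set (Source V) :=
  {s | match s with
    | .x j _ => j < k
    -- The edge compression of round `j` first enters `z` at round `j + 1`, hence `x` at round `j +
    -- 2`.
    | .z j _ => j + 1 < k
    | .batch _ _ _ => False}

theorem past_mono {k l : ℕ} (h : k ≤ l) : past V k ⊆ past V l := by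
  rintro (⟨j, i⟩ | ⟨j, i⟩ | ⟨j, t, i⟩) hs
  · exact lt_of_lt_of_le (show j < k from hs) h
  · exact lt_of_lt_of_le (show j + 1 < k from hs) h
  · exact hs

theorem x_notMem_past (k : ℕ) (i : V) : Source.x k i ∉ past V k :=
  fun h => lt_irrefl k h

theorem z_notMem_past (k : ℕ) (i : V) : Source.z k i ∉ past V (k + 1) :=
  fun h => lt_irrefl (k + 1) h

theorem sourceSigma_mono {T T' : Set (Source V)} (h : T ⊆ T') :
    sourceSigma ξ ζ B T ≤ sourceSigma ξ ζ B T' :=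
  biSup_mono h

theorem measurable_node_seed {T : Set (Source V)} {k : ℕ} {i : V} (h : Source.x k i ∈ T) :
    Measurable[sourceSigma ξ ζ B T] (ξ k i) := by
  refine Measurable.mono (comap_measurable (ξ k i)) ?_ le_rfl
  exact le_biSup (sourceAlgebra ξ ζ B) h

theorem measurable_edge_seed {T : Set (Source V)} {k : ℕ} {i j : V} (h : Source.z k i ∈ T) :
    Measurable[sourceSigma ξ ζ B T] (ζ k i j) := by
  refine Measurable.mono (comap_measurable (ζ k i j)) ?_ le_rfl
  exact (le_iSup (fun j => MeasurableSpace.comap (ζ k i j) inferInstance) j).trans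
    (le_biSup (sourceAlgebra ξ ζ B) h)

namespace IsRandomInput

theorem sourceAlgebra_le (hR : IsRandomInput P G b p C ξ ζ B) (s : Source V) :
    sourceAlgebra ξ ζ B s ≤ (inferInstance : MeasurableSpace Ω) := by
  rcases s with ⟨k, i⟩ | ⟨k, i⟩ | ⟨k, t, i⟩
  · exact (hR.measurable_ξ k i).comap_le
  · exact iSup_le fun j => (hR.measurable_ζ k i j).comap_le
  · exact (hR.measurable_B k t i).comap_le

theorem sourceSigma_le (hR : IsRandomInput P G b p C ξ ζ B) (T : Set (Source V)) :
    sourceSigma ξ ζ B T ≤ (inferInstance : MeasurableSpace Ω) :=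
  iSup₂_le fun s _ => hR.sourceAlgebra_le s

theorem indep_source (hR : IsRandomInput P G b p C ξ ζ B) {s : Source V} {T : Set (Source V)}
    (hs : s ∉ T) : Indep (sourceAlgebra ξ ζ B s) (sourceSigma ξ ζ B T) P := by
  have h := indep_iSup_of_disjoint hR.sourceAlgebra_le hR.indep
    (Set.disjoint_singleton_left.2 hs)
  simpa [sourceSigma] using h

theorem indep_node_seed (hR : IsRandomInput P G b p C ξ ζ B) {k : ℕ} {i : V}
    {T : Set (Source V)} (hs : Source.x k i ∉ T) :
    Indep (MeasurableSpace.comap (ξ k i) inferInstance) (sourceSigma ξ ζ B T) P :=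
  hR.indep_source hs

theorem indep_edge_seed (hR : IsRandomInput P G b p C ξ ζ B) {k : ℕ} {i j : V}
    {T : Set (Source V)} (hs : Source.z k i ∉ T) :
    Indep (MeasurableSpace.comap (ζ k i j) inferInstance) (sourceSigma ξ ζ B T) P :=
  indep_of_indep_of_le_left (hR.indep_source hs)
    (le_iSup (fun j => MeasurableSpace.comap (ζ k i j) inferInstance) j)

end IsRandomInput

end Sources

/-! ### Measurability and noise estimates along the trajectory -/

section Trajectory

variable {V Ω S : Type*} [Fintype V] [MeasurableSpace Ω] [MeasurableSpace S] {P : Measure Ω}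
  [IsProbabilityMeasure P]
  (G : SimpleGraph V) [DecidableRel G.Adj] {n : ℕ} {m b : V → ℕ} {p : ℝ}
  (γ β η : ℝ) (f : ∀ i, Fin (m i) → Vec n → ℝ) (C : V → S → Vec n → Vec n)
  (ξ : ℕ → V → Ω → S) (ζ : ℕ → V → V → Ω → S) (B : ℕ → ℕ → ∀ i : V, Ω → Finset (Fin (m i)))
  (x₀ : V → Vec n)

/-- The random state of the network after `k` rounds, with `r = ρ = 1` and a single local
training step. -/
def randomRun (k : ℕ) (ω : Ω) : State V n :=
  run G (Params.mk γ β 1 1 η 1) f (fun k t i => B k t i ω) (fun k i => C i (ξ k i ω))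
    (fun k i j => C i (ζ k i j ω)) x₀ k

local notation "σ" => randomRun G γ β η f C ξ ζ B x₀

omit [MeasurableSpace Ω] [MeasurableSpace S] in
theorem xhat_sub_x (k : ℕ) (ω : Ω) (i : V) : (σ k ω).xhat i - (σ k ω).x i
    = C i (ξ k i ω) ((σ k ω).x i - (σ k ω).u i) - ((σ k ω).x i - (σ k ω).u i) := by
  simp only [randomRun, run_xhat]
  abel

omit [MeasurableSpace Ω] [MeasurableSpace S] in
theorem zhat_sub_z (k : ℕ) (ω : Ω) (i j : V) : (σ k ω).zhat i j - (σ k ω).z i j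
    = C i (ζ k i j ω) ((σ k ω).z i j - (σ k ω).s i j) - ((σ k ω).z i j - (σ k ω).s i j) := by
  simp only [randomRun, run_zhat]
  abel

variable {G C ξ ζ B f}

/-- Measurability and square integrability of the variables of round `k`. -/
structure RoundAdapted (P : Measure Ω) (G : SimpleGraph V) (ξ : ℕ → V → Ω → S)
    (ζ : ℕ → V → V → Ω → S) (B : ℕ → ℕ → ∀ i : V, Ω → Finset (Fin (m i))) (k : ℕ)
    (τ : Ω → State V n) : Prop where
  x : ∀ i, AdaptedL2 P (sourceSigma ξ ζ B (past V k)) fun ω => (τ ω).x i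
  u : ∀ i, AdaptedL2 P (sourceSigma ξ ζ B (past V k)) fun ω => (τ ω).u i
  -- The edge variables already contain the node compression of the same round, so they are one
  -- index later than `x`.
  z : ∀ i j, G.Adj i j → AdaptedL2 P (sourceSigma ξ ζ B (past V (k + 1))) fun ω => (τ ω).z i j
  s : ∀ i j, G.Adj i j → AdaptedL2 P (sourceSigma ξ ζ B (past V (k + 1))) fun ω => (τ ω).s i j

theorem adapted_node_noise (hR : IsRandomInput P G b p C ξ ζ B) {k : ℕ}
    (h : RoundAdapted P G ξ ζ B k (σ k)) (i : V) :
    AdaptedL2 P (sourceSigma ξ ζ B (past V (k + 1)))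
      fun ω => (σ k ω).xhat i - (σ k ω).x i := by
  simp_rw [xhat_sub_x]
  exact AdaptedL2.compression_error (sourceSigma_mono (past_mono k.le_succ))
    (hR.sourceSigma_le _) (measurable_node_seed (Nat.lt_succ_self k))
    (hR.indep_node_seed (x_notMem_past k i)) (hR.compressor_x k i) ((h.x i).sub (h.u i))

theorem adapted_edge_noise (hR : IsRandomInput P G b p C ξ ζ B) {k : ℕ}
    (h : RoundAdapted P G ξ ζ B k (σ k)) {i j : V} (hij : G.Adj i j) {T : Set (Source V)}
    (hT : past V (k + 1) ⊆ T) (hi : Source.z k i ∈ T) :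
    AdaptedL2 P (sourceSigma ξ ζ B T) fun ω => (σ k ω).zhat i j - (σ k ω).z i j := by
  simp_rw [zhat_sub_z]
  exact AdaptedL2.compression_error (sourceSigma_mono hT)
    (hR.sourceSigma_le _) (measurable_edge_seed hi)
    (hR.indep_edge_seed (z_notMem_past k i)) (hR.compressor_z k i j hij)
    ((h.z i j hij).sub (h.s i j hij))

theorem roundAdapted (hR : IsRandomInput P G b p C ξ ζ B)
    (hf : ∀ i h, Differentiable ℝ (f i h)) {L : ℝ} (hL : ∀ i, LSmooth L (localCost (f i)))
    (k : ℕ) : RoundAdapted P G ξ ζ B k (σ k) := by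
  have hsub : ∀ k, sourceSigma ξ ζ B (past V k) ≤ sourceSigma ξ ζ B (past V (k + 1)) :=
    fun k => sourceSigma_mono (past_mono k.le_succ)
  induction k with
  | zero =>
    exact ⟨fun i => AdaptedL2.const _, fun i => AdaptedL2.const _, fun i j _ => AdaptedL2.const _,
      fun i j _ => AdaptedL2.const _⟩
  | succ k ih =>
    have hxhat : ∀ i, AdaptedL2 P (sourceSigma ξ ζ B (past V (k + 1)))
        fun ω => (σ k ω).xhat i := fun i => by
      simpa using (adapted_node_noise γ β η x₀ hR ih i).add ((ih.x i).mono (hsub k))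
    have hzhat : ∀ i j, G.Adj i j → AdaptedL2 P (sourceSigma ξ ζ B (past V (k + 2)))
        fun ω => (σ k ω).zhat i j := fun i j hij => by
      simpa using (adapted_edge_noise γ β η x₀ hR ih hij (past_mono (k + 1).le_succ)
        (Nat.lt_succ_self (k + 1))).add ((ih.z i j hij).mono (hsub (k + 1)))
    have hx : ∀ i, AdaptedL2 P (sourceSigma ξ ζ B (past V (k + 1)))
        fun ω => (σ (k + 1) ω).x i := fun i => by
      have e : ∀ ω, (σ (k + 1) ω).x i = (σ k ω).x i - γ • ∇ (localCost (f i)) ((σ k ω).x i)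
          - β • ∑ j ∈ G.neighborFinset i, ((σ k ω).x i - (σ k ω).z i j) := fun ω =>
        run_x_succ G γ β η f _ _ _ x₀ k hf i
      simp_rw [e]
      have hlip : LipschitzWith L.toNNReal (∇ (localCost (f i))) :=
        LipschitzWith.of_dist_le_mul fun x y => by
          rw [dist_eq_norm, dist_eq_norm]
          exact ((hL i).2 x y).trans
            (mul_le_mul_of_nonneg_right (Real.le_coe_toNNReal L) (norm_nonneg _))
      have hxi := (ih.x i).mono (hsub k)
      refine (hxi.sub ((AdaptedL2.lipschitz hlip hxi).const_smul γ)).sub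
        (AdaptedL2.const_smul (AdaptedL2.sum fun j hj => ?_) β)
      exact hxi.sub (ih.z i j ((G.mem_neighborFinset i j).1 hj))
    have hu : ∀ i, AdaptedL2 P (sourceSigma ξ ζ B (past V (k + 1)))
        fun ω => (σ (k + 1) ω).u i := fun i =>
      (((ih.u i).mono (hsub k)).const_smul (1 - η)).add ((hxhat i).const_smul η)
    have hxhat' : ∀ i, AdaptedL2 P (sourceSigma ξ ζ B (past V (k + 2)))
        fun ω => (σ (k + 1) ω).xhat i := fun i => by
      have h : AdaptedL2 P (sourceSigma ξ ζ B (past V (k + 2)))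
          fun ω => (σ (k + 1) ω).xhat i - (σ (k + 1) ω).x i := by
        simp_rw [xhat_sub_x]
        exact AdaptedL2.compression_error (hsub (k + 1)) (hR.sourceSigma_le _)
          (measurable_node_seed (Nat.lt_succ_self (k + 1)))
          (hR.indep_node_seed (x_notMem_past (k + 1) i)) (hR.compressor_x (k + 1) i)
          ((hx i).sub (hu i))
      simpa using h.add ((hx i).mono (hsub (k + 1)))
    refine ⟨hx, hu, fun i j hij => ?_, hzhat⟩
    have e : ∀ ω, (σ (k + 1) ω).z i j = (1 / 2 : ℝ) • ((σ k ω).zhat i j - (σ k ω).zhat j i)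
        + (σ (k + 1) ω).x i - ((σ (k + 1) ω).xhat i - (σ (k + 1) ω).xhat j) := fun ω =>
      run_z_succ G γ β η f _ _ _ x₀ k i j
    simp_rw [e]
    exact ((((hzhat i j hij).sub (hzhat j i hij.symm)).const_smul _).add
      ((hx i).mono (hsub (k + 1)))).sub ((hxhat' i).sub (hxhat' j))

theorem adapted_node {k : ℕ} (h : RoundAdapted P G ξ ζ B k (σ k)) : AdaptedL2 P (sourceSigma ξ ζ B (past V k)) fun ω => (σ k ω).node :=
  AdaptedL2.piLp fun i => h.x i

theorem adapted_nodeGap {k : ℕ} (h : RoundAdapted P G ξ ζ B k (σ k)) :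
    AdaptedL2 P (sourceSigma ξ ζ B (past V k)) fun ω => (σ k ω).nodeGap :=
  AdaptedL2.piLp fun i => (h.x i).sub (h.u i)

theorem adapted_nodeNoise {k : ℕ} (hR : IsRandomInput P G b p C ξ ζ B)
    (h : RoundAdapted P G ξ ζ B k (σ k)) :
    AdaptedL2 P (sourceSigma ξ ζ B (past V (k + 1))) fun ω => (σ k ω).nodeNoise :=
  AdaptedL2.piLp fun i => adapted_node_noise γ β η x₀ hR h i

theorem adapted_edge {k : ℕ} (h : RoundAdapted P G ξ ζ B k (σ k)) :
    AdaptedL2 P (sourceSigma ξ ζ B (past V (k + 1))) fun ω => (σ k ω).edge G := by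
  refine AdaptedL2.piLp fun e => ?_
  simp only [State.edge]
  split_ifs with he
  · exact h.z _ _ he
  · exact AdaptedL2.const _

theorem adapted_edgeGap {k : ℕ} (h : RoundAdapted P G ξ ζ B k (σ k)) :
    AdaptedL2 P (sourceSigma ξ ζ B (past V (k + 1))) fun ω => (σ k ω).edgeGap G := by
  refine AdaptedL2.piLp fun e => ?_
  simp only [State.edgeGap]
  split_ifs with he
  · exact (h.z _ _ he).sub (h.s _ _ he)
  · exact AdaptedL2.const _

theorem adapted_edgeNoise {k : ℕ} (hR : IsRandomInput P G b p C ξ ζ B)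
    (h : RoundAdapted P G ξ ζ B k (σ k)) :
    AdaptedL2 P (sourceSigma ξ ζ B (past V (k + 2))) fun ω => (σ k ω).edgeNoise G := by
  refine AdaptedL2.piLp fun e => ?_
  simp only [State.edgeNoise]
  split_ifs with he
  · exact adapted_edge_noise γ β η x₀ hR h he (past_mono (k + 1).le_succ)
      (Nat.lt_succ_self (k + 1))
  · exact AdaptedL2.const _

theorem integral_nodeNoise_le {k : ℕ} (hR : IsRandomInput P G b p C ξ ζ B)
    (h : RoundAdapted P G ξ ζ B k (σ k)) (hp : 0 ≤ p) :
    ∫ ω, ‖(σ k ω).nodeNoise‖ ^ 2 ∂P ≤ p * ∫ ω, ‖(σ k ω).nodeGap‖ ^ 2 ∂P := by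
  rw [integral_norm_sq_piLp (adapted_nodeNoise γ β η x₀ hR h).2,
    integral_norm_sq_piLp (adapted_nodeGap γ β η x₀ h).2, Finset.mul_sum]
  refine Finset.sum_le_sum fun i _ => ?_
  simp only [State.nodeNoise, State.nodeGap, xhat_sub_x]
  exact integral_compression_error_le (hR.sourceSigma_le _) hp (hR.measurable_ξ k i)
    (hR.indep_node_seed (x_notMem_past k i)) (hR.compressor_x k i) ((h.x i).sub (h.u i))

theorem integral_edge_noise_le {k : ℕ} (hR : IsRandomInput P G b p C ξ ζ B)
    (h : RoundAdapted P G ξ ζ B k (σ k)) (hp : 0 ≤ p) (e : V × V) :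
    ∫ ω, ‖(σ k ω).edgeNoise G e‖ ^ 2 ∂P ≤ p * ∫ ω, ‖(σ k ω).edgeGap G e‖ ^ 2 ∂P := by
  simp only [State.edgeNoise, State.edgeGap, zhat_sub_z]
  split_ifs with he
  · exact integral_compression_error_le (hR.sourceSigma_le _) hp (hR.measurable_ζ k e.1 e.2)
      (hR.indep_edge_seed (z_notMem_past k e.1)) (hR.compressor_z k _ _ he)
      ((h.z _ _ he).sub (h.s _ _ he))
  · simp

theorem integral_edgeNoise_le {k : ℕ} (hR : IsRandomInput P G b p C ξ ζ B)
    (h : RoundAdapted P G ξ ζ B k (σ k)) (hp : 0 ≤ p) :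
    ∫ ω, ‖(σ k ω).edgeNoise G‖ ^ 2 ∂P ≤ p * ∫ ω, ‖(σ k ω).edgeGap G‖ ^ 2 ∂P := by
  rw [integral_norm_sq_piLp (adapted_edgeNoise γ β η x₀ hR h).2,
    integral_norm_sq_piLp (adapted_edgeGap γ β η x₀ h).2, Finset.mul_sum]
  exact Finset.sum_le_sum fun e _ => integral_edge_noise_le γ β η x₀ hR h hp e

/-- The set `T` may exceed the past, so that the test vector can contain the noise of the other end
of the edge. -/
theorem integral_inner_edge_noise {k : ℕ} (hR : IsRandomInput P G b p C ξ ζ B)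
    (h : RoundAdapted P G ξ ζ B k (σ k)) {A : Ω → Vec n} {e : V × V} {T : Set (Source V)}
    (hT : past V (k + 1) ⊆ T) (he : Source.z k e.1 ∉ T)
    (hA : AdaptedL2 P (sourceSigma ξ ζ B T) A) :
    ∫ ω, inner ℝ ((σ k ω).edgeNoise G e) (A ω) ∂P = 0 := by
  simp only [State.edgeNoise, zhat_sub_z]
  split_ifs with hadj
  · exact integral_inner_compression_error (hR.sourceSigma_le _) (hR.measurable_ζ k e.1 e.2)
      (hR.indep_edge_seed he) (hR.compressor_z k _ _ hadj)
      (((h.z _ _ hadj).sub (h.s _ _ hadj)).mono (sourceSigma_mono hT)) hA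
  · simp

theorem integral_inner_edgeNoise {k : ℕ} (hR : IsRandomInput P G b p C ξ ζ B)
    (h : RoundAdapted P G ξ ζ B k (σ k)) {A : Ω → Edges V n}
    (hA : AdaptedL2 P (sourceSigma ξ ζ B (past V (k + 1))) A) :
    ∫ ω, inner ℝ ((σ k ω).edgeNoise G) (A ω) ∂P = 0 := by
  rw [integral_inner_piLp (adapted_edgeNoise γ β η x₀ hR h) hA]
  exact Finset.sum_eq_zero fun e _ => integral_inner_edge_noise γ β η x₀ hR h subset_rfl
    (z_notMem_past k e.1) (hA.eval_piLp e)

theorem integral_inner_nodeNoise {k : ℕ} (hR : IsRandomInput P G b p C ξ ζ B)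
    (h : RoundAdapted P G ξ ζ B k (σ k)) {A : Ω → Nodes V n}
    (hA : AdaptedL2 P (sourceSigma ξ ζ B (past V k)) A) :
    ∫ ω, inner ℝ ((σ k ω).nodeNoise) (A ω) ∂P = 0 := by
  rw [integral_inner_piLp (adapted_nodeNoise γ β η x₀ hR h) hA]
  refine Finset.sum_eq_zero fun i _ => ?_
  simp only [State.nodeNoise, xhat_sub_x]
  exact integral_inner_compression_error (hR.sourceSigma_le _) (hR.measurable_ξ k i)
    (hR.indep_node_seed (x_notMem_past k i)) (hR.compressor_x k i) ((h.x i).sub (h.u i))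
    (hA.eval_piLp i)

/-- Averaging the independent compression errors of the two ends of an edge halves the
variance. -/
theorem integral_symPart_edgeNoise_le {k : ℕ} (hR : IsRandomInput P G b p C ξ ζ B)
    (h : RoundAdapted P G ξ ζ B k (σ k)) (hp : 0 ≤ p) :
    ∫ ω, ‖symPart V n ((σ k ω).edgeNoise G)‖ ^ 2 ∂P
      ≤ p / 2 * ∫ ω, ‖(σ k ω).edgeGap G‖ ^ 2 ∂P := by
  have hN := adapted_edgeNoise γ β η x₀ hR h
  have hE := adapted_edgeGap γ β η x₀ h
  rw [integral_norm_sq_piLp (hN.clm (symPart V n)).2, integral_norm_sq_piLp hE.2]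
  -- Only the two opposite ends of one edge need to be uncorrelated; they belong to different
  -- agents. Dependence among the edges of one agent is harmless.
  have horth : ∀ e : V × V,
      ∫ ω, inner ℝ ((σ k ω).edgeNoise G e) ((σ k ω).edgeNoise G e.swap) ∂P = 0 := by
    intro e
    by_cases he : G.Adj e.1 e.2
    · refine integral_inner_edge_noise γ β η x₀ hR h
        (Set.subset_insert (Source.z k e.2) (past V (k + 1))) ?_ ?_
      · rintro (h1 | h1)
        · injection h1 with _ h1
          exact he.ne h1
        · exact z_notMem_past k e.1 h1
      · have := adapted_edge_noise γ β η x₀ hR h he.symm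
          (Set.subset_insert (Source.z k e.2) (past V (k + 1))) (Set.mem_insert _ _)
        simpa only [State.edgeNoise, Prod.fst_swap, Prod.snd_swap, if_pos he.symm] using this
    · simp [State.edgeNoise, he]
  have hterm : ∀ e : V × V, ∫ ω, ‖symPart V n ((σ k ω).edgeNoise G) e‖ ^ 2 ∂P
      ≤ p / 4 * (∫ ω, ‖(σ k ω).edgeGap G e‖ ^ 2 ∂P)
        + p / 4 * ∫ ω, ‖(σ k ω).edgeGap G e.swap‖ ^ 2 ∂P := by
    intro e
    have h1 : ∀ ω, ‖symPart V n ((σ k ω).edgeNoise G) e‖ ^ 2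
        = 1 / 4 * ‖(σ k ω).edgeNoise G e + (σ k ω).edgeNoise G e.swap‖ ^ 2 := fun ω => by
      rw [symPart_apply, norm_smul, mul_pow]
      norm_num
    simp_rw [h1]
    rw [integral_const_mul, integral_norm_add_sq (hN.eval_piLp e) (hN.eval_piLp e.swap), horth]
    have b1 := integral_edge_noise_le γ β η x₀ hR h hp e
    have b2 := integral_edge_noise_le γ β η x₀ hR h hp e.swap
    linarith
  refine (Finset.sum_le_sum fun e _ => hterm e).trans ?_
  have hswap := (Equiv.prodComm V V).sum_comp (fun e => ∫ ω, ‖(σ k ω).edgeGap G e‖ ^ 2 ∂P)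
  simp only [Equiv.prodComm_apply] at hswap
  rw [Finset.sum_add_distrib, ← Finset.mul_sum, ← Finset.mul_sum, hswap]
  apply le_of_eq
  ring

end Trajectory

/-! ### Stacked gradient and optimality -/

section Objective

variable {V : Type*} [Fintype V] {n : ℕ} {m : V → ℕ} {f : ∀ i, Fin (m i) → Vec n → ℝ} {μ L : ℝ}

theorem stackedGrad_strongly_monotone (hf : ∀ i, StronglyConvex μ (localCost (f i)))
    (x y : Nodes V n) :
    μ * ‖x - y‖ ^ 2 ≤ inner ℝ (stackedGrad f x - stackedGrad f y) (x - y) := by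
  have e : ‖x - y‖ ^ 2 = ∑ i, ‖(x - y) i‖ ^ 2 := PiLp.norm_sq_eq_of_L2 _ (x - y)
  rw [e, PiLp.inner_apply, Finset.mul_sum]
  exact Finset.sum_le_sum fun i _ => hf i (x i) (y i)

theorem norm_stackedGrad_sub_le (hL0 : 0 ≤ L) (hf : ∀ i, LSmooth L (localCost (f i)))
    (x y : Nodes V n) : ‖stackedGrad f x - stackedGrad f y‖ ≤ L * ‖x - y‖ := by
  refine le_of_sq_le_sq ?_ (by positivity)
  have e1 : ‖x - y‖ ^ 2 = ∑ i, ‖(x - y) i‖ ^ 2 := PiLp.norm_sq_eq_of_L2 _ (x - y)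
  have e2 : ‖stackedGrad f x - stackedGrad f y‖ ^ 2
      = ∑ i, ‖(stackedGrad f x - stackedGrad f y) i‖ ^ 2 := PiLp.norm_sq_eq_of_L2 _ _
  rw [mul_pow, e1, e2, Finset.mul_sum]
  refine Finset.sum_le_sum fun i _ => ?_
  rw [← mul_pow]
  exact pow_le_pow_left₀ (norm_nonneg _) ((hf i).2 (x i) (y i)) 2

theorem sum_gradient_eq_zero (hf : ∀ i, LSmooth L (localCost (f i))) {xopt : Vec n}
    (hopt : ∀ y, ∑ i, localCost (f i) xopt ≤ ∑ i, localCost (f i) y) :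
    ∑ i, ∇ (localCost (f i)) xopt = 0 := by
  have h1 : fderiv ℝ (fun y => ∑ i, localCost (f i) y) xopt = 0 :=
    IsLocalMin.fderiv_eq_zero (Filter.Eventually.of_forall hopt)
  rw [fderiv_fun_sum fun i _ => (hf i).1 xopt] at h1
  simp only [gradient]
  rw [← map_sum, h1, map_zero]

theorem edgeMap_diff_const (G : SimpleGraph V) [DecidableRel G.Adj] (x : Vec n) :
    edgeMap G n 1 (-1) (WithLp.toLp 2 fun _ : V => x) = 0 := by
  ext e : 1
  rw [edgeMap_apply]
  split_ifs
  · simp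
  · rfl

end Objective

/-! ### The coupled recursions in expectation -/

theorem norm_sq_split_le {E : Type*} [NormedAddCommGroup E] [InnerProductSpace ℝ E]
    (s a b c : E) : ‖-s + ((a + (-(1 / 2 : ℝ)) • b) + -c)‖ ^ 2
      ≤ 7 / 6 * ‖s‖ ^ 2 + 28 * ‖a‖ ^ 2 + 7 * ‖b‖ ^ 2 + 14 * ‖c‖ ^ 2 := by
  have y1 := norm_add_sq_le_young (θ := 1 / 6) (by norm_num) (-s) ((a + (-(1 / 2 : ℝ)) • b) + -c)
  have y2 := norm_add_sq_le_two (a + (-(1 / 2 : ℝ)) • b) (-c)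
  have y3 := norm_add_sq_le_two a ((-(1 / 2 : ℝ)) • b)
  have e : ‖(-(1 / 2 : ℝ)) • b‖ ^ 2 = 1 / 4 * ‖b‖ ^ 2 := by
    rw [norm_smul, mul_pow]
    norm_num
  have e2 : (1 / 6 : ℝ)⁻¹ = 6 := by norm_num
  rw [e] at y3
  rw [norm_neg] at y1 y2
  rw [e2] at y1
  linarith

/-- The contraction factor is `7/6 * (p/2)`, at most `7/8` when `p ≤ 3/2`. -/
theorem edgeGap_bound_of_parts {E' Sy N E D X H T F p : ℝ}
    (h : E' ≤ 7 / 6 * Sy + 28 * T * D + 7 * F * X + 14 * F * N)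
    (hS : Sy ≤ p / 2 * E) (hN : N ≤ p * H) (hp : p ≤ 3 / 2) (hT : 0 ≤ T) (hF : 0 ≤ F)
    (hE : 0 ≤ E) (hD : 0 ≤ D) (hX : 0 ≤ X) (hH : 0 ≤ H) :
    E' ≤ 7 / 8 * E + 28 * (T + F) * (D + X + H) := by
  have m1 : p / 2 * E ≤ 3 / 4 * E := mul_le_mul_of_nonneg_right (by linarith) hE
  have m2 : 14 * F * N ≤ 14 * F * (3 / 2 * H) :=
    mul_le_mul_of_nonneg_left (hN.trans (mul_le_mul_of_nonneg_right hp hH)) (by positivity)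
  have m3 : 0 ≤ T * X := by positivity
  have m4 : 0 ≤ T * H := by positivity
  have m5 : 0 ≤ F * D := by positivity
  have m6 : 0 ≤ F * H := by positivity
  have m7 : 0 ≤ F * X := by positivity
  linarith

section Recursion

variable {V Ω S : Type*} [Fintype V] [MeasurableSpace Ω] [MeasurableSpace S] {P : Measure Ω}
  [IsProbabilityMeasure P]
  {G : SimpleGraph V} [DecidableRel G.Adj] {n : ℕ} {m b : V → ℕ} {p : ℝ}
  {γ β η : ℝ} {f : ∀ i, Fin (m i) → Vec n → ℝ} {C : V → S → Vec n → Vec n}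
  {ξ : ℕ → V → Ω → S} {ζ : ℕ → V → V → Ω → S} {B : ℕ → ℕ → ∀ i : V, Ω → Finset (Fin (m i))}
  {x₀ : V → Vec n}

local notation "σ" => randomRun G γ β η f C ξ ζ B x₀
local notation "Dif" => edgeMap G n 1 (-1)

/-- The damped gap and the noise are orthogonal, which gives the factor `(1 - η) ^ 2 + η ^ 2 * p`.
The primal increment may correlate with the noise and is split off by Young's inequality with half
the spectral margin. -/
theorem integral_nodeGap_succ_le (hR : IsRandomInput P G b p C ξ ζ B) (hp : 0 ≤ p)
    (h : ∀ k, RoundAdapted P G ξ ζ B k (σ k)) (hq : (1 - η) ^ 2 + η ^ 2 * p < 1) (k : ℕ) :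
    ∫ ω, ‖(σ (k + 1) ω).nodeGap‖ ^ 2 ∂P
      ≤ (1 + ((1 - η) ^ 2 + η ^ 2 * p)) / 2 * ∫ ω, ‖(σ k ω).nodeGap‖ ^ 2 ∂P
        + (1 + ((1 - ((1 - η) ^ 2 + η ^ 2 * p)) / 2)⁻¹)
          * ∫ ω, ‖(σ (k + 1) ω).node - (σ k ω).node‖ ^ 2 ∂P := by
  set q := (1 - η) ^ 2 + η ^ 2 * p with hqdef
  have hθ : 0 < (1 - q) / 2 := by linarith
  have hgap := adapted_nodeGap γ β η x₀ (h k)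
  have hnoise := adapted_nodeNoise γ β η x₀ hR (h k)
  have hd := (adapted_node γ β η x₀ (h (k + 1))).sub
    ((adapted_node γ β η x₀ (h k)).mono (sourceSigma_mono (past_mono k.le_succ)))
  have ha := hgap.const_smul (1 - η)
  have hw := hnoise.const_smul (-η)
  have hv := (ha.mono (sourceSigma_mono (past_mono k.le_succ))).add hw
  have hpt : ∀ ω, ‖(σ (k + 1) ω).nodeGap‖ ^ 2
      ≤ (1 + (1 - q) / 2) * ‖(1 - η) • (σ k ω).nodeGap + (-η) • (σ k ω).nodeNoise‖ ^ 2
        + (1 + ((1 - q) / 2)⁻¹) * ‖(σ (k + 1) ω).node - (σ k ω).node‖ ^ 2 := fun ω => by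
    have e : (σ (k + 1) ω).nodeGap = ((1 - η) • (σ k ω).nodeGap + (-η) • (σ k ω).nodeNoise)
        + ((σ (k + 1) ω).node - (σ k ω).node) := by
      simp only [randomRun]
      rw [nodeGap_succ]
      module
    rw [e]
    exact norm_add_sq_le_young hθ _ _
  have hint := integral_mono (adapted_nodeGap γ β η x₀ (h (k + 1))).integrable_norm_sq
    ((hv.integrable_norm_sq.const_mul (1 + (1 - q) / 2)).add
      (hd.integrable_norm_sq.const_mul (1 + ((1 - q) / 2)⁻¹))) hpt
  rw [integral_add' (hv.integrable_norm_sq.const_mul _) (hd.integrable_norm_sq.const_mul _),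
    integral_const_mul, integral_const_mul] at hint
  have hsq : ∫ ω, ‖(1 - η) • (σ k ω).nodeGap + (-η) • (σ k ω).nodeNoise‖ ^ 2 ∂P
      ≤ q * ∫ ω, ‖(σ k ω).nodeGap‖ ^ 2 ∂P := by
    rw [integral_norm_add_sq ha hw]
    simp_rw [inner_smul_left, inner_smul_right, norm_smul, mul_pow]
    have horth : ∫ ω, inner ℝ (σ k ω).nodeGap (σ k ω).nodeNoise ∂P = 0 := by
      simp_rw [real_inner_comm (σ k _).nodeNoise]
      exact integral_inner_nodeNoise γ β η x₀ hR (h k) hgap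
    have hb := mul_le_mul_of_nonneg_left (integral_nodeNoise_le γ β η x₀ hR (h k) hp)
      (sq_nonneg η)
    simp only [integral_const_mul, horth, mul_zero, Real.norm_eq_abs, sq_abs, neg_sq]
    rw [hqdef]
    linarith
  have hX0 : 0 ≤ ∫ ω, ‖(σ k ω).nodeGap‖ ^ 2 ∂P := integral_nonneg fun ω => by positivity
  have hfac : (1 + (1 - q) / 2) * q ≤ (1 + q) / 2 := by nlinarith [sq_nonneg (1 - q)]
  calc _ ≤ _ := hint
    _ ≤ (1 + (1 - q) / 2) * (q * ∫ ω, ‖(σ k ω).nodeGap‖ ^ 2 ∂P) + _ := by gcongr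
    _ = ((1 + (1 - q) / 2) * q) * ∫ ω, ‖(σ k ω).nodeGap‖ ^ 2 ∂P + _ := by rw [mul_assoc]
    _ ≤ _ := by gcongr

theorem integral_edgeGap_succ_le (hR : IsRandomInput P G b p C ξ ζ B) (hp : 0 ≤ p)
    (hp' : p ≤ 3 / 2) (h : ∀ k, RoundAdapted P G ξ ζ B k (σ k)) (xopt : Vec n) (k : ℕ) :
    ∫ ω, ‖(σ (k + 1) ω).edgeGap G‖ ^ 2 ∂P
      ≤ 7 / 8 * ∫ ω, ‖(σ k ω).edgeGap G‖ ^ 2 ∂P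
        + 28 * (‖edgeMap G n (1 / 2) (1 / 2) - (1 / 2 : ℝ) • Dif‖ ^ 2 + ‖Dif‖ ^ 2)
          * (∫ ω, ‖(σ (k + 1) ω).node - (σ k ω).node‖ ^ 2 ∂P
            + ∫ ω, ‖(σ k ω).node - WithLp.toLp 2 fun _ => xopt‖ ^ 2 ∂P
            + ∫ ω, ‖(σ (k + 1) ω).nodeGap‖ ^ 2 ∂P) := by
  set T := edgeMap G n (1 / 2) (1 / 2) - (1 / 2 : ℝ) • Dif with hT
  set xs : Nodes V n := WithLp.toLp 2 fun _ => xopt with hxs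
  have hX := adapted_node γ β η x₀ (h k)
  have hx := hX.sub (AdaptedL2.const xs)
  have hd := (adapted_node γ β η x₀ (h (k + 1))).sub
    (hX.mono (sourceSigma_mono (past_mono k.le_succ)))
  have hw := adapted_nodeNoise γ β η x₀ hR (h (k + 1))
  have hs := (adapted_edgeNoise γ β η x₀ hR (h k)).clm (symPart V n)
  have hpt : ∀ ω, ‖(σ (k + 1) ω).edgeGap G‖ ^ 2
      ≤ 7 / 6 * ‖symPart V n ((σ k ω).edgeNoise G)‖ ^ 2
        + 28 * ‖T‖ ^ 2 * ‖(σ (k + 1) ω).node - (σ k ω).node‖ ^ 2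
        + 7 * ‖Dif‖ ^ 2 * ‖(σ k ω).node - xs‖ ^ 2
        + 14 * ‖Dif‖ ^ 2 * ‖(σ (k + 1) ω).nodeNoise‖ ^ 2 := fun ω => by
    have hD0 : Dif xs = 0 := edgeMap_diff_const G xopt
    have e : (σ (k + 1) ω).edgeGap G = -(symPart V n ((σ k ω).edgeNoise G))
        + ((T ((σ (k + 1) ω).node - (σ k ω).node)
            + (-(1 / 2 : ℝ)) • Dif ((σ k ω).node - xs))
          + -(Dif (σ (k + 1) ω).nodeNoise)) := by
      simp only [randomRun]
      rw [edgeGap_succ]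
      simp only [hT, sub_apply, smul_apply, map_sub, hD0]
      module
    have y := norm_sq_split_le (symPart V n ((σ k ω).edgeNoise G))
      (T ((σ (k + 1) ω).node - (σ k ω).node)) (Dif ((σ k ω).node - xs))
      (Dif (σ (k + 1) ω).nodeNoise)
    rw [← e] at y
    have b1 := pow_le_pow_left₀ (norm_nonneg _)
      (T.le_opNorm ((σ (k + 1) ω).node - (σ k ω).node)) 2
    have b2 := pow_le_pow_left₀ (norm_nonneg _) ((Dif).le_opNorm ((σ k ω).node - xs)) 2
    have b3 := pow_le_pow_left₀ (norm_nonneg _) ((Dif).le_opNorm (σ (k + 1) ω).nodeNoise) 2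
    rw [mul_pow] at b1 b2 b3
    linarith
  have i1 := hs.integrable_norm_sq.const_mul (7 / 6)
  have i2 := hd.integrable_norm_sq.const_mul (28 * ‖T‖ ^ 2)
  have i3 := hx.integrable_norm_sq.const_mul (7 * ‖Dif‖ ^ 2)
  have i4 := hw.integrable_norm_sq.const_mul (14 * ‖Dif‖ ^ 2)
  have hint := integral_mono (adapted_edgeGap γ β η x₀ (h (k + 1))).integrable_norm_sq
    (((i1.add i2).add i3).add i4) hpt
  rw [integral_add' ((i1.add i2).add i3) i4, integral_add' (i1.add i2) i3, integral_add' i1 i2,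
    integral_const_mul, integral_const_mul, integral_const_mul, integral_const_mul] at hint
  have n1 := integral_symPart_edgeNoise_le γ β η x₀ hR (h k) hp
  have n2 := integral_nodeNoise_le γ β η x₀ hR (h (k + 1)) hp
  exact edgeGap_bound_of_parts hint n1 n2 hp' (sq_nonneg _) (sq_nonneg _)
    (integral_nonneg fun ω => by positivity) (integral_nonneg fun ω => by positivity)
    (integral_nonneg fun ω => by positivity) (integral_nonneg fun ω => by positivity)

/-- The increment of the node variables, relative to a saddle point. -/
theorem node_increment (hf : ∀ i h, Differentiable ℝ (f i h)) {xopt : Vec n} {zs : Edges V n}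
    (hzs : (β / 2) • ContinuousLinearMap.adjoint Dif zs
      = γ • stackedGrad f (WithLp.toLp 2 fun _ => xopt)) (k : ℕ) (ω : Ω) :
    (σ (k + 1) ω).node - (σ k ω).node
      = -(γ • (stackedGrad f (σ k ω).node - stackedGrad f (WithLp.toLp 2 fun _ => xopt)))
        - (β / 4) • ContinuousLinearMap.adjoint Dif
          (Dif ((σ k ω).node - WithLp.toLp 2 fun _ => xopt))
        + (β / 2) • ContinuousLinearMap.adjoint Dif ((σ k ω).edge G - zs) := by
  have e := node_succ G γ β η f (fun k t i => B k t i ω) (fun k i => C i (ξ k i ω))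
    (fun k i j => C i (ζ k i j ω)) x₀ k hf
  simp only [randomRun]
  rw [e, map_sub, edgeMap_diff_const, sub_zero, map_sub, smul_sub (β / 2), hzs]
  module

/-- Pointwise descent applies to the noiseless dual update; the noise then contributes its second
moment only. -/
theorem integral_energy_succ_le (hR : IsRandomInput P G b p C ξ ζ B) (hp : 0 ≤ p)
    (hf : ∀ i h, Differentiable ℝ (f i h)) {μ L : ℝ} (hL0 : 0 ≤ L)
    (hL : ∀ i, LSmooth L (localCost (f i))) (hμ : ∀ i, StronglyConvex μ (localCost (f i)))
    (hγ : 0 < γ) (hβ : 0 < β) (hγL : 2 * γ * L ^ 2 ≤ μ) (hβD : β * ‖Dif‖ ^ 2 ≤ 1)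
    (h : ∀ k, RoundAdapted P G ξ ζ B k (σ k)) {xopt : Vec n} {zs : Edges V n}
    (hzs : (β / 2) • ContinuousLinearMap.adjoint Dif zs
      = γ • stackedGrad f (WithLp.toLp 2 fun _ => xopt)) (k : ℕ) :
    ∫ ω, ‖(σ (k + 1) ω).node - WithLp.toLp 2 fun _ => xopt‖ ^ 2 ∂P
        + β * ∫ ω, ‖rangeProj Dif ((σ (k + 1) ω).edge G - zs)‖ ^ 2 ∂P
      ≤ ∫ ω, ‖(σ k ω).node - WithLp.toLp 2 fun _ => xopt‖ ^ 2 ∂P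
        + β * ∫ ω, ‖rangeProj Dif ((σ k ω).edge G - zs)‖ ^ 2 ∂P
        - (∫ ω, ‖(σ (k + 1) ω).node - (σ k ω).node‖ ^ 2 ∂P) / 4
        - γ * μ * ∫ ω, ‖(σ k ω).node - WithLp.toLp 2 fun _ => xopt‖ ^ 2 ∂P
        + 2 * β * p * (∫ ω, ‖(σ k ω).edgeGap G‖ ^ 2 ∂P
          + ‖Dif‖ ^ 2 * ∫ ω, ‖(σ (k + 1) ω).nodeGap‖ ^ 2 ∂P) := by
  set xs : Nodes V n := WithLp.toLp 2 fun _ => xopt with hxs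
  have hX := adapted_node γ β η x₀ (h k)
  have hX' := adapted_node γ β η x₀ (h (k + 1))
  have hx := hX.sub (AdaptedL2.const xs)
  have hx' := hX'.sub (AdaptedL2.const xs)
  have hd := hX'.sub (hX.mono (sourceSigma_mono (past_mono k.le_succ)))
  have hw := adapted_nodeNoise γ β η x₀ hR (h (k + 1))
  have hN := adapted_edgeNoise γ β η x₀ hR (h k)
  have hQ := ((adapted_edge γ β η x₀ (h k)).sub (AdaptedL2.const zs)).clm (rangeProj Dif)
  have ha := hQ.sub ((hx'.clm Dif).const_smul (1 / 2))
  have hν := (hN.clm (rangeProj Dif)).sub (hw.clm Dif)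
  have hsplit : ∀ ω, rangeProj Dif ((σ (k + 1) ω).edge G - zs)
      = (rangeProj Dif ((σ k ω).edge G - zs) - (1 / 2 : ℝ) • Dif ((σ (k + 1) ω).node - xs))
        + (rangeProj Dif ((σ k ω).edgeNoise G) - Dif (σ (k + 1) ω).nodeNoise) := fun ω => by
    have e := rangeProj_edge_succ G γ β η f (fun k t i => B k t i ω) (fun k i => C i (ξ k i ω))
      (fun k i j => C i (ζ k i j ω)) x₀ k
    have hD0 : Dif xs = 0 := edgeMap_diff_const G xopt
    simp only [randomRun]
    rw [map_sub, e, map_sub, map_sub, hD0]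
    module
  -- The noiseless update uses the old `z` and the new `x`, both known at `past V (k + 1)`. The edge
  -- noise of round `k` and the node noise of round `k + 1` are both fresh relative to it.
  have horth : ∫ ω, inner ℝ
      (rangeProj Dif ((σ k ω).edge G - zs) - (1 / 2 : ℝ) • Dif ((σ (k + 1) ω).node - xs))
      (rangeProj Dif ((σ k ω).edgeNoise G) - Dif (σ (k + 1) ω).nodeNoise) ∂P = 0 := by
    have o1 := integral_inner_edgeNoise γ β η x₀ hR (h k) (ha.clm (rangeProj Dif))
    have o2 := integral_inner_nodeNoise γ β η x₀ hR (h (k + 1))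
      (ha.clm (ContinuousLinearMap.adjoint Dif))
    have e : ∀ ω, inner ℝ
        (rangeProj Dif ((σ k ω).edge G - zs) - (1 / 2 : ℝ) • Dif ((σ (k + 1) ω).node - xs))
        (rangeProj Dif ((σ k ω).edgeNoise G) - Dif (σ (k + 1) ω).nodeNoise)
        = inner ℝ ((σ k ω).edgeNoise G) (rangeProj Dif (rangeProj Dif ((σ k ω).edge G - zs)
            - (1 / 2 : ℝ) • Dif ((σ (k + 1) ω).node - xs)))
          - inner ℝ ((σ (k + 1) ω).nodeNoise) (ContinuousLinearMap.adjoint Dif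
            (rangeProj Dif ((σ k ω).edge G - zs)
              - (1 / 2 : ℝ) • Dif ((σ (k + 1) ω).node - xs))) := fun ω => by
      rw [ContinuousLinearMap.adjoint_inner_right, ← inner_rangeProj_left, ← inner_sub_left,
        real_inner_comm]
    simp_rw [e]
    rw [integral_sub (hN.integrable_inner (ha.clm (rangeProj Dif)))
      (hw.integrable_inner (ha.clm (ContinuousLinearMap.adjoint Dif))), o1, o2, sub_zero]
  have hdual : ∫ ω, ‖rangeProj Dif ((σ (k + 1) ω).edge G - zs)‖ ^ 2 ∂P
      = ∫ ω, ‖rangeProj Dif ((σ k ω).edge G - zs)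
          - (1 / 2 : ℝ) • Dif ((σ (k + 1) ω).node - xs)‖ ^ 2 ∂P
        + ∫ ω, ‖rangeProj Dif ((σ k ω).edgeNoise G) - Dif (σ (k + 1) ω).nodeNoise‖ ^ 2 ∂P := by
    simp_rw [hsplit]
    rw [integral_norm_add_sq ha hν, horth, mul_zero, add_zero]
  have hνle : ∫ ω, ‖rangeProj Dif ((σ k ω).edgeNoise G) - Dif (σ (k + 1) ω).nodeNoise‖ ^ 2 ∂P
      ≤ 2 * (p * ∫ ω, ‖(σ k ω).edgeGap G‖ ^ 2 ∂P)
        + 2 * ‖Dif‖ ^ 2 * (p * ∫ ω, ‖(σ (k + 1) ω).nodeGap‖ ^ 2 ∂P) := by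
    have hpt : ∀ ω, ‖rangeProj Dif ((σ k ω).edgeNoise G) - Dif (σ (k + 1) ω).nodeNoise‖ ^ 2
        ≤ 2 * ‖(σ k ω).edgeNoise G‖ ^ 2
          + 2 * ‖Dif‖ ^ 2 * ‖(σ (k + 1) ω).nodeNoise‖ ^ 2 := fun ω => by
      have y := norm_add_sq_le_two (rangeProj Dif ((σ k ω).edgeNoise G))
        (-(Dif (σ (k + 1) ω).nodeNoise))
      have b1 := pow_le_pow_left₀ (norm_nonneg _)
        (norm_rangeProj_le Dif ((σ k ω).edgeNoise G)) 2
      have b2 := pow_le_pow_left₀ (norm_nonneg _) ((Dif).le_opNorm (σ (k + 1) ω).nodeNoise) 2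
      rw [mul_pow] at b2
      rw [← sub_eq_add_neg, norm_neg] at y
      linarith
    have j1 := hN.integrable_norm_sq.const_mul 2
    have j2 := hw.integrable_norm_sq.const_mul (2 * ‖Dif‖ ^ 2)
    have hint := integral_mono hν.integrable_norm_sq (j1.add j2) hpt
    rw [integral_add' j1 j2, integral_const_mul, integral_const_mul] at hint
    refine hint.trans (add_le_add ?_ ?_)
    · exact mul_le_mul_of_nonneg_left (integral_edgeNoise_le γ β η x₀ hR (h k) hp) (by norm_num)
    · exact mul_le_mul_of_nonneg_left (integral_nodeNoise_le γ β η x₀ hR (h (k + 1)) hp)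
        (by positivity)
  have hpt : ∀ ω, ‖(σ (k + 1) ω).node - xs‖ ^ 2
      + β * ‖rangeProj Dif ((σ k ω).edge G - zs)
          - (1 / 2 : ℝ) • Dif ((σ (k + 1) ω).node - xs)‖ ^ 2
      ≤ ‖(σ k ω).node - xs‖ ^ 2 + β * ‖rangeProj Dif ((σ k ω).edge G - zs)‖ ^ 2
        - ‖(σ (k + 1) ω).node - (σ k ω).node‖ ^ 2 / 4
        - γ * μ * ‖(σ k ω).node - xs‖ ^ 2 := fun ω => by
    have hD : ∀ x, β * ‖Dif x‖ ^ 2 ≤ ‖x‖ ^ 2 := fun x => by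
      have b1 := pow_le_pow_left₀ (norm_nonneg _) ((Dif).le_opNorm x) 2
      rw [mul_pow] at b1
      calc β * ‖Dif x‖ ^ 2 ≤ β * (‖Dif‖ ^ 2 * ‖x‖ ^ 2) := by gcongr
        _ = (β * ‖Dif‖ ^ 2) * ‖x‖ ^ 2 := by ring
        _ ≤ 1 * ‖x‖ ^ 2 := by gcongr
        _ = ‖x‖ ^ 2 := one_mul _
    have hdesc := primal_dual_descent Dif hγ hβ hγL hD
      (stackedGrad_strongly_monotone hμ (σ k ω).node xs)
      (norm_stackedGrad_sub_le hL0 hL (σ k ω).node xs) (node_increment hf hzs k ω)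
    have e : (σ k ω).node - xs + ((σ (k + 1) ω).node - (σ k ω).node)
        = (σ (k + 1) ω).node - xs := by abel
    rwa [e] at hdesc
  have i1 := hx'.integrable_norm_sq
  have i2 := ha.integrable_norm_sq.const_mul β
  have i3 := hx.integrable_norm_sq
  have i4 := hQ.integrable_norm_sq.const_mul β
  have i5 := hd.integrable_norm_sq.div_const 4
  have i6 := hx.integrable_norm_sq.const_mul (γ * μ)
  have hint := integral_mono (i1.add i2) (((i3.add i4).sub i5).sub i6) hpt
  rw [integral_add' i1 i2, integral_sub' ((i3.add i4).sub i5) i6, integral_sub' (i3.add i4) i5,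
    integral_add' i3 i4, integral_const_mul, integral_const_mul, integral_const_mul,
    integral_div] at hint
  rw [hdual]
  have := mul_le_mul_of_nonneg_left hνle hβ.le
  linarith

theorem integral_dual_error_le
    (hf : ∀ i h, Differentiable ℝ (f i h)) {L : ℝ} (hL0 : 0 ≤ L)
    (hL : ∀ i, LSmooth L (localCost (f i))) (hγ : 0 < γ) (hβ : 0 < β)
    (h : ∀ k, RoundAdapted P G ξ ζ B k (σ k)) {xopt : Vec n} {zs : Edges V n}
    (hzs : (β / 2) • ContinuousLinearMap.adjoint Dif zs
      = γ • stackedGrad f (WithLp.toLp 2 fun _ => xopt)) {cP : ℝ} (hcP : 0 ≤ cP)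
    (hproj : ∀ z, ‖rangeProj Dif z‖ ^ 2 ≤ cP * ‖ContinuousLinearMap.adjoint Dif z‖ ^ 2)
    (k : ℕ) :
    β ^ 2 * ∫ ω, ‖rangeProj Dif ((σ k ω).edge G - zs)‖ ^ 2 ∂P
      ≤ cP * 8 * (1 + (γ * L + β / 4 * ‖Dif‖ ^ 2) ^ 2)
        * (∫ ω, ‖(σ (k + 1) ω).node - (σ k ω).node‖ ^ 2 ∂P
          + ∫ ω, ‖(σ k ω).node - WithLp.toLp 2 fun _ => xopt‖ ^ 2 ∂P) := by
  set xs : Nodes V n := WithLp.toLp 2 fun _ => xopt with hxs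
  have hX := adapted_node γ β η x₀ (h k)
  have hx := hX.sub (AdaptedL2.const xs)
  have hd := (adapted_node γ β η x₀ (h (k + 1))).sub
    (hX.mono (sourceSigma_mono (past_mono k.le_succ)))
  have hQ := ((adapted_edge γ β η x₀ (h k)).sub (AdaptedL2.const zs)).clm (rangeProj Dif)
  have hpt := fun ω => dual_error_le Dif hβ (norm_nonneg Dif) (Dif).le_opNorm hγ hcP hproj
    (norm_stackedGrad_sub_le hL0 hL (σ k ω).node xs) (node_increment hf hzs k ω)
  rw [← integral_const_mul, ← integral_add hd.integrable_norm_sq hx.integrable_norm_sq,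
    ← integral_const_mul]
  exact integral_mono (hQ.integrable_norm_sq.const_mul _)
    ((hd.integrable_norm_sq.add hx.integrable_norm_sq).const_mul _) hpt

end Recursion

/-! ### Choice of parameters and conclusion -/

theorem exists_pos_mul_le_three {a b c a' b' c' : ℝ} (ha : 0 ≤ a) (hb : 0 ≤ b) (hc : 0 ≤ c)
    (ha' : 0 < a') (hb' : 0 < b') (hc' : 0 < c') :
    ∃ t : ℝ, 0 < t ∧ t * a ≤ a' ∧ t * b ≤ b' ∧ t * c ≤ c' := by
  have key : ∀ u v t : ℝ, 0 ≤ u → 0 < v → t ≤ v / (u + 1) → t * u ≤ v := by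
    intro u v t hu hv ht
    calc t * u ≤ v / (u + 1) * u := by gcongr
      _ = v * (u / (u + 1)) := by ring
      _ ≤ v * 1 := by
        gcongr
        rw [div_le_one (by positivity)]
        linarith
      _ = v := mul_one v
  refine ⟨min (a' / (a + 1)) (min (b' / (b + 1)) (c' / (c + 1))), by positivity,
    key _ _ _ ha ha' (min_le_left _ _),
    key _ _ _ hb hb' ((min_le_right _ _).trans (min_le_left _ _)),
    key _ _ _ hc hc' ((min_le_right _ _).trans (min_le_right _ _))⟩

end

end LTADMM

theorem theorem1 {V : Type*} [Fintype V] (G : SimpleGraph V) [DecidableRel G.Adj]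
    (hG : G.Connected) (n : ℕ) (m b : V → ℕ) (hb : ∀ i, 1 ≤ b i ∧ b i ≤ m i)
    (μ L : ℝ) (hμ : 0 < μ) (hμL : μ ≤ L) :
    ∃ pmax : ℝ, 1 < pmax ∧ ∀ p : ℝ, 0 ≤ p → p ≤ pmax →
    ∀ η : ℝ, 0 < η → η ≤ 1 → η * p < 1 →
    ∃ γmax : ℝ, 0 < γmax ∧ ∀ γ : ℝ, 0 < γ → γ ≤ γmax →
    ∃ (β r ρ : ℝ) (τ : ℕ), 0 < β ∧ 0 < r ∧ 0 < ρ ∧ 0 < τ ∧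
    ∃ c : ℝ, 0 < c ∧ c < 1 ∧
    ∀ f : (i : V) → Fin (m i) → LTADMM.Vec n → ℝ,
      (∀ i h, Differentiable ℝ (f i h)) →
      (∀ i, LTADMM.LSmooth L (LTADMM.localCost (f i))) →
      (∀ i, LTADMM.StronglyConvex μ (LTADMM.localCost (f i))) →
    ∀ {Ω S : Type*} [MeasurableSpace Ω] [MeasurableSpace S] (P : Measure Ω)
      [IsProbabilityMeasure P] (C : V → S → LTADMM.Vec n → LTADMM.Vec n)
      (ξ : ℕ → V → Ω → S) (ζ : ℕ → V → V → Ω → S)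
      (B : ℕ → ℕ → (i : V) → Ω → Finset (Fin (m i))),
      LTADMM.IsRandomInput P G b p C ξ ζ B →
    ∀ (x₀ : V → LTADMM.Vec n) (xopt : LTADMM.Vec n),
      (∀ y, ∑ i, LTADMM.localCost (f i) xopt ≤ ∑ i, LTADMM.localCost (f i) y) →
    ∃ M : ℝ, ∀ k : ℕ,
      (∀ i, MemLp (fun ω => LTADMM.trajectory G ⟨γ, β, r, ρ, η, τ⟩ f C ξ ζ B x₀ k i ω - xopt)
        2 P) ∧
      ∫ ω, ∑ i, ‖LTADMM.trajectory G ⟨γ, β, r, ρ, η, τ⟩ f C ξ ζ B x₀ k i ω - xopt‖ ^ 2 ∂P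
        ≤ M * c ^ k := by
  have hL0 : 0 < L := hμ.trans_le hμL
  refine ⟨3 / 2, by norm_num, fun p hp hp' η hη hη1 hηp => ⟨μ / (2 * L ^ 2), by positivity,
    fun γ hγ hγ' => ?_⟩⟩
  have hγL : 2 * γ * L ^ 2 ≤ μ := by
    have := (le_div_iff₀ (by positivity)).1 hγ'
    linarith
  obtain ⟨cP, hcP, hproj⟩ := LTADMM.exists_norm_rangeProj_sq_le (LTADMM.edgeMap G n 1 (-1))
  set D := LTADMM.edgeMap G n 1 (-1) with hD
  set q := (1 - η) ^ 2 + η ^ 2 * p with hqdef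
  -- This amounts to `η * (1 + p) < 2`, which follows from `η ≤ 1` and `η * p < 1`.
  have hq : q < 1 := by nlinarith
  have hq0 : 0 ≤ q := by positivity
  have hq2 : 0 < (1 - q) / 2 := by linarith
  set C₁ := 1 + ((1 - q) / 2)⁻¹ with hC₁
  have hC₁0 : 0 ≤ C₁ := by positivity
  set C₂ := 28 * (‖LTADMM.edgeMap G n (1 / 2) (1 / 2) - (1 / 2 : ℝ) • D‖ ^ 2 + ‖D‖ ^ 2) with hC₂
  have hC₂0 : 0 ≤ C₂ := by positivity
  have hκ : (1 + q) / 2 < 1 := by linarith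
  have hκ' : 0 < 1 - (1 + q) / 2 := by linarith
  -- The three smallness conditions on `β` are the two of the Lyapunov argument and `β * ‖D‖ ^ 2 ≤
  -- 1` for descent. They involve no cost function, so `β` and `c` are fixed before `f`.
  obtain ⟨β, hβ, hβ1, hβ2, hβD⟩ := LTADMM.exists_pos_mul_le_three
    (a := (2 * (3 * ‖D‖ ^ 2 + 48 * C₂) / (1 - (1 + q) / 2) + (3 * ‖D‖ ^ 2 + 48 * C₂)) * C₁
      + 48 * C₂) (b := 48 * C₂) (c := ‖D‖ ^ 2) (a' := 1 / 8) (b' := γ * μ / 2) (c' := 1)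
    (by positivity) (by positivity) (by positivity) (by norm_num) (by positivity) (by norm_num)
  obtain ⟨c, hc0, hc1, hc⟩ := LTADMM.linear_rate_of_recursion hκ hC₂0
    (C₃ := cP * 8 * (1 + (γ * L + β / 4 * ‖D‖ ^ 2) ^ 2)) (by positivity) (sq_nonneg ‖D‖) hp'
    (mul_pos hγ hμ) hβ hβ1 hβ2
  refine ⟨β, 1, 1, 1, hβ, one_pos, one_pos, one_pos, c, hc0, hc1, ?_⟩
  intro f hf hfL hfμ Ω S _ _ P _ C ξ ζ B hR x₀ xopt hopt
  -- Optimality makes the local gradients sum to zero, so a dual variable balances them and the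
  -- optimum becomes a fixed point of the noiseless round.
  obtain ⟨zs, hzs⟩ := LTADMM.exists_adjoint_diff_eq G hG (n := n)
    (v := (2 * γ / β) • LTADMM.stackedGrad f (WithLp.toLp 2 fun _ => xopt)) (by
      change ∑ i, (2 * γ / β) • gradient (LTADMM.localCost (f i)) xopt = 0
      rw [← Finset.smul_sum, LTADMM.sum_gradient_eq_zero hfL hopt, smul_zero])
  have hzs' : (β / 2) • ContinuousLinearMap.adjoint D zs
      = γ • LTADMM.stackedGrad f (WithLp.toLp 2 fun _ => xopt) := by
    rw [hzs, smul_smul]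
    congr 1
    field_simp
  have h : ∀ k, LTADMM.RoundAdapted P G ξ ζ B k (LTADMM.randomRun G γ β η f C ξ ζ B x₀ k) :=
    LTADMM.roundAdapted γ β η x₀ hR hf hfL
  obtain ⟨M, hM⟩ := hc
    (fun k => ∫ ω, ‖(LTADMM.randomRun G γ β η f C ξ ζ B x₀ k ω).node
      - WithLp.toLp 2 fun _ => xopt‖ ^ 2 ∂P)
    (fun k => ∫ ω, ‖LTADMM.rangeProj D
      ((LTADMM.randomRun G γ β η f C ξ ζ B x₀ k ω).edge G - zs)‖ ^ 2 ∂P)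
    (fun k => ∫ ω, ‖(LTADMM.randomRun G γ β η f C ξ ζ B x₀ k ω).nodeGap‖ ^ 2 ∂P)
    (fun k => ∫ ω, ‖(LTADMM.randomRun G γ β η f C ξ ζ B x₀ k ω).edgeGap G‖ ^ 2 ∂P)
    (fun k => ∫ ω, ‖(LTADMM.randomRun G γ β η f C ξ ζ B x₀ (k + 1) ω).node
      - (LTADMM.randomRun G γ β η f C ξ ζ B x₀ k ω).node‖ ^ 2 ∂P)
    (fun k => integral_nonneg fun ω => sq_nonneg _)
    (fun k => integral_nonneg fun ω => sq_nonneg _)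
    (fun k => integral_nonneg fun ω => sq_nonneg _)
    (fun k => integral_nonneg fun ω => sq_nonneg _)
    (fun k => integral_nonneg fun ω => sq_nonneg _)
    (LTADMM.integral_energy_succ_le hR hp hf hL0.le hfL hfμ hγ hβ hγL hβD h hzs')
    (LTADMM.integral_nodeGap_succ_le hR hp h hq)
    (LTADMM.integral_edgeGap_succ_le hR hp hp' h xopt)
    (LTADMM.integral_dual_error_le hf hL0.le hfL hγ hβ h hzs' hcP.le hproj)
  refine ⟨M, fun k => ⟨fun i => ((h k).x i).2.sub (memLp_const xopt), ?_⟩⟩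
  refine le_trans (le_of_eq (integral_congr_ae (Filter.Eventually.of_forall fun ω => ?_))) (hM k)
  exact (PiLp.norm_sq_eq_of_L2 _ ((LTADMM.randomRun G γ β η f C ξ ζ B x₀ k ω).node
      - WithLp.toLp 2 fun _ => xopt)).symm
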